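/- Let $L^2_+(\mathbb R)=\{f\in L^2(\mathbb R):\ \operatorname{supp}\hat f\subset[0,\infty)\}$ be the Hardy space, let $\Pi f(x)=\frac1{2\pi}\int_0^\infty e^{ix\xi}\hat f(\xi)\,d\xi$ be the Szegő projector, and let $H^{1/2}_+(\mathbb R)$ be the space of $u\in L^2_+(\mathbb R)$ with $\int_0^\infty(1+|\xi|^2)^{1/2}|\hat u(\xi)|^2\,d\xi<\infty$. For $u\in H^{1/2}_+(\mathbb R)$ let $H_u:L^2_+(\mathbb R)\to L^2_+(\mathbb R)$, $H_u(h)=\Pi(u\bar h)$, be the ($\mathbb C$-antilinear) Hankel operator with symbol $u$. For an integer $N\ge1$ let $\mathcal M(N)$ be the set of rational fractions $A(z)/B(z)$ with $A,B\in\mathbb C[z]$ without common factors, $A\neq0$, $\deg A\le N-1$, $\deg B=N$, $B(0)=1$, and $B(z)\ne0$ whenever $\operatorname{Im}z\ge0$; they are identified with their restrictions to $\mathbb R$. Then: 1. $\mathcal M(N)\subset H^{1/2}_+(\mathbb R)$, and a function $u\in H^{1/2}_+(\mathbb R)$ belongs to $\mathcal M(N)$ if and only if $\operatorname{Ran}H_u$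 has complex dimension $N$ (that is, $H_u$ has complex rank $N$). 2. If $u\in\mathcal M(N)$ is written as $u=A/B$ with $A\in\mathbb C[z]$ and $B(z)=\prod_{j=1}^J(z-p_j)^{m_j}$, where the $p_j$ are pairwise distinct, $\operatorname{Im}p_j<0$, $m_j\ge1$ and $\sum_{j=1}^Jm_j=N$, then $$\operatorname{Ran}H_u=\operatorname{span}_{\mathbb C}\Big\{\frac1{(z-p_j)^m}:\ 1\le j\le J,\ 1\le m\le m_j\Big\}.$$ -/

import Mathlib

open MeasureTheory FourierTransform SchwartzMap
open scoped ENNReal Polynomial ComplexConjugate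

noncomputable section

namespace Szego

/-! ### The Hardy space, the Sobolev spaces, the Szegő projector

The Fourier transform is Mathlib's `𝓕 f ξ = ∫ f x * exp (-2 π i x ξ) dx` (and its extension to
`L²`).  With the other usual normalisation `f^ ξ = ∫ f x * exp (-i x ξ) dx` one has
`f^ (2 π ξ) = 𝓕 f ξ`, which explains the factor `2 π` in the Sobolev weight below. -/

/-- `L²(ℝ)`, complex valued. -/
abbrev L2 : Type := Lp ℂ 2 (volume : Measure ℝ)

/-- The Hardy space `L²₊(ℝ)`: square integrable functions whose Fourier transform is
supported in `[0, ∞)`. -/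
def hardySpace : Submodule ℂ L2 where
  carrier := {f | ∀ᵐ ξ : ℝ, ξ < 0 → (𝓕 f : L2) ξ = 0}
  zero_mem' := by
    have h0 : (𝓕 (0 : L2) : L2) = 0 := (Lp.fourierTransformₗᵢ ℝ ℂ).map_zero
    change ∀ᵐ ξ : ℝ, ξ < 0 → (𝓕 (0 : L2) : L2) ξ = 0
    rw [h0]
    filter_upwards [Lp.coeFn_zero ℂ 2 (volume : Measure ℝ)] with ξ hξ _
    exact hξ
  add_mem' := by
    intro f g hf hg
    change ∀ᵐ ξ : ℝ, ξ < 0 → (𝓕 (f + g) : L2) ξ = 0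
    rw [FourierTransform.fourier_add]
    filter_upwards [hf, hg, Lp.coeFn_add (𝓕 f : L2) (𝓕 g)] with ξ h1 h2 h3 h
    rw [h3, Pi.add_apply, h1 h, h2 h, add_zero]
  smul_mem' := by
    intro c f hf
    change ∀ᵐ ξ : ℝ, ξ < 0 → (𝓕 (c • f) : L2) ξ = 0
    rw [FourierTransform.fourier_smul]
    filter_upwards [hf, Lp.coeFn_smul c (𝓕 f : L2)] with ξ h1 h3 h
    rw [h3, Pi.smul_apply, h1 h, smul_zero]

/-- The Sobolev space `H^s₊(ℝ)`: the `h ∈ L²₊(ℝ)` with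
`∫_{0}^{∞} (1 + |ξ|²)^s |h^ ξ|² dξ < ∞`. -/
def hardySobolev (s : ℝ) : Set L2 :=
  {h | h ∈ hardySpace ∧
    ∫⁻ ξ in Set.Ici (0 : ℝ),
      ENNReal.ofReal ((1 + |2 * Real.pi * ξ| ^ 2) ^ s) * ‖(𝓕 h : L2) ξ‖ₑ ^ 2 < ∞}

/-- The frequency side of the Szegő projector: the Fourier transform of `f`, cut off to the
non-negative frequencies. -/
def szegoSpectrum (f : ℝ → ℂ) : ℝ → ℂ := (Set.Ici (0 : ℝ)).indicator (𝓕 f)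

/-- The Szegő projector `Π f x = ∫_{0}^{∞} exp (2 π i x ξ) 𝓕 f ξ dξ` (inverse Fourier transform
in the sense of `L²`), for integrable `f` such that the cut-off Fourier transform is in `L²`.
On `L¹ ∩ L²` this is the orthogonal projection onto `L²₊(ℝ)`, by `fourier_toLp_ae_eq` below. -/
def szegoProj (f : ℝ → ℂ) (hf : MemLp (szegoSpectrum f) 2 (volume : Measure ℝ)) : hardySpace :=
  ⟨(𝓕⁻ (hf.toLp (szegoSpectrum f)) : L2), by
    change ∀ᵐ ξ : ℝ, ξ < 0 → (𝓕 (𝓕⁻ (hf.toLp (szegoSpectrum f)) : L2) : L2) ξ = 0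
    rw [FourierTransform.fourier_fourierInv_eq]
    filter_upwards [hf.coeFn_toLp] with ξ hξ h
    rw [hξ, szegoSpectrum, Set.indicator_of_notMem (by simpa using h)]⟩

theorem fourier_szegoProj (f : ℝ → ℂ) (hf : MemLp (szegoSpectrum f) 2 (volume : Measure ℝ)) :
    (𝓕 (szegoProj f hf : L2) : L2) = hf.toLp (szegoSpectrum f) :=
  FourierTransform.fourier_fourierInv_eq _

theorem szegoProj_add {f g k : ℝ → ℂ} (hfgk : k =ᵐ[volume] fun x => f x + g x)
    (hf1 : Integrable f) (hg1 : Integrable g)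
    (hk : MemLp (szegoSpectrum k) 2 (volume : Measure ℝ))
    (hf : MemLp (szegoSpectrum f) 2 (volume : Measure ℝ))
    (hg : MemLp (szegoSpectrum g) 2 (volume : Measure ℝ)) :
    szegoProj k hk = szegoProj f hf + szegoProj g hg := by
  refine Subtype.ext ((Lp.fourierTransformₗᵢ ℝ ℂ).injective ?_)
  change (𝓕 (szegoProj k hk : L2) : L2) = 𝓕 ((szegoProj f hf : L2) + (szegoProj g hg : L2))
  rw [FourierTransform.fourier_add, fourier_szegoProj, fourier_szegoProj, fourier_szegoProj,
    ← MemLp.toLp_add]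
  refine MemLp.toLp_congr _ _ (Filter.Eventually.of_forall fun ξ => ?_)
  have e : 𝓕 k ξ = 𝓕 f ξ + 𝓕 g ξ := by
    simp only [Real.fourier_eq]
    rw [← integral_add ((Real.fourierIntegral_convergent_iff ξ).2 hf1)
      ((Real.fourierIntegral_convergent_iff ξ).2 hg1)]
    refine integral_congr_ae ?_
    filter_upwards [hfgk] with x hx
    rw [hx, smul_add]
  by_cases h0 : 0 ≤ ξ <;> simp [szegoSpectrum, Set.indicator, h0, e]

theorem szegoProj_smul {f k : ℝ → ℂ} {c : ℂ} (hfk : k =ᵐ[volume] fun x => c * f x)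
    (hk : MemLp (szegoSpectrum k) 2 (volume : Measure ℝ))
    (hf : MemLp (szegoSpectrum f) 2 (volume : Measure ℝ)) :
    szegoProj k hk = c • szegoProj f hf := by
  refine Subtype.ext ((Lp.fourierTransformₗᵢ ℝ ℂ).injective ?_)
  change (𝓕 (szegoProj k hk : L2) : L2) = 𝓕 (c • (szegoProj f hf : L2))
  rw [FourierTransform.fourier_smul, fourier_szegoProj, fourier_szegoProj,
    ← MemLp.toLp_const_smul]
  refine MemLp.toLp_congr _ _ (Filter.Eventually.of_forall fun ξ => ?_)
  have e : 𝓕 k ξ = c * 𝓕 f ξ := by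
    simp only [Real.fourier_eq]
    rw [← integral_const_mul]
    refine integral_congr_ae ?_
    filter_upwards [hfk] with x hx
    rw [hx, Circle.smul_def, Circle.smul_def, smul_eq_mul, smul_eq_mul]
    ring
  by_cases h0 : 0 ≤ ξ <;> simp [szegoSpectrum, Set.indicator, h0, e]

/-! ### The product of an `H^{1/2}₊` function and a conjugate `L²₊` function

The function `u * conj h` is integrable; its Szegő projection is again in `L²₊`. -/

/-- A test-function criterion for the `L²` Fourier transform. -/
theorem fourier_ae_eq_of_test (f : L2) (g : ℝ → ℂ) (hg : LocallyIntegrable g)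
    (h : ∀ φ : 𝓢(ℝ, ℂ), ∫ x, φ x • g x = ∫ x, (𝓕 φ : 𝓢(ℝ, ℂ)) x • f x) :
    (𝓕 f : L2) =ᵐ[volume] g := by
  have hF : LocallyIntegrable ((𝓕 f : L2) : ℝ → ℂ) :=
    (Lp.memLp (𝓕 f : L2)).locallyIntegrable (by norm_num)
  refine ae_eq_of_integral_contDiff_smul_eq hF hg ?_
  intro ψ hψ hc
  have hc' : HasCompactSupport (fun x => (ψ x : ℂ)) := hc.comp_left (g := fun r : ℝ => (r : ℂ)) (by simp)
  have hψ' : ContDiff ℝ (⊤ : ℕ∞) (fun x => (ψ x : ℂ)) := Complex.ofRealCLM.contDiff.comp hψ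
  let φ : 𝓢(ℝ, ℂ) := hc'.toSchwartzMap hψ'
  have e : ∀ x, φ x = (ψ x : ℂ) := fun x => rfl
  have h1 := congrArg (fun T => T φ) (Lp.fourier_toTemperedDistribution_eq f)
  simp only [TemperedDistribution.fourier_apply, Lp.toTemperedDistribution_apply] at h1
  have h2 := h φ
  rw [h1] at h2
  simp only [e, Complex.real_smul, smul_eq_mul] at h2 ⊢
  exact h2.symm

theorem continuous_fourier {f : ℝ → ℂ} (h1 : Integrable f) : Continuous (𝓕 f) :=
  VectorFourier.fourierIntegral_continuous Real.continuous_fourierChar continuous_inner h1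

/-- On `L¹ ∩ L²` the `L²` Fourier transform is given by the Fourier integral. -/
theorem fourier_toLp_ae_eq (f : ℝ → ℂ) (h1 : Integrable f) (h2 : MemLp f 2 volume) :
    (𝓕 (h2.toLp f) : L2) =ᵐ[volume] 𝓕 f := by
  refine fourier_ae_eq_of_test _ _ (continuous_fourier h1).locallyIntegrable fun φ => ?_
  have := VectorFourier.integral_fourierIntegral_smul_eq_flip (L := innerₗ ℝ) (μ := volume)
    (ν := volume) (f := φ) (g := f) Real.continuous_fourierChar continuous_inner φ.integrable h1
  simp only [flip_innerₗ] at this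
  refine Eq.trans this.symm ?_
  refine integral_congr_ae ?_
  filter_upwards [h2.coeFn_toLp] with x hx
  rw [hx, SchwartzMap.fourier_coe]
  rfl

theorem memLp_modulate (u : L2) (a : ℝ) :
    MemLp (fun x : ℝ => (Real.fourierChar (-(x * a)) : ℂ) * u x) 2 volume := by
  refine (Lp.memLp u).of_le_mul (c := 1) ?_ ?_
  · refine AEStronglyMeasurable.mul ?_ (Lp.aestronglyMeasurable u)
    refine Continuous.aestronglyMeasurable ?_
    have := Real.continuous_fourierChar
    fun_prop
  · filter_upwards with x
    rw [norm_mul, Circle.norm_coe]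

theorem fourier_modulate (u : L2) (a : ℝ) :
    (𝓕 ((memLp_modulate u a).toLp _) : L2) =ᵐ[volume] fun ζ => (𝓕 u : L2) (ζ + a) := by
  have hmp : MeasurePreserving (fun ζ : ℝ => ζ + a) volume volume :=
    measurePreserving_add_right volume a
  have hloc : MemLp (fun ζ => (𝓕 u : L2) (ζ + a)) 2 volume :=
    (Lp.memLp (𝓕 u : L2)).comp_measurePreserving hmp
  refine fourier_ae_eq_of_test _ _ (hloc.locallyIntegrable (by norm_num)) fun φ => ?_
  have h1 := congrArg (fun T => T (φ.compSubConstCLM ℂ a)) (Lp.fourier_toTemperedDistribution_eq u)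
  simp only [TemperedDistribution.fourier_apply, Lp.toTemperedDistribution_apply,
    SchwartzMap.compSubConstCLM_apply] at h1
  have h2 := integral_add_right_eq_self (μ := (volume : Measure ℝ))
    (fun ζ : ℝ => φ (ζ - a) • (𝓕 u : L2) ζ) a
  simp only [add_sub_cancel_right] at h2
  rw [h2, ← h1]
  refine integral_congr_ae ?_
  filter_upwards [(memLp_modulate u a).coeFn_toLp] with x hx
  rw [hx]
  have h3 : (𝓕 (φ.compSubConstCLM ℂ a) : 𝓢(ℝ, ℂ)) x
      = (Real.fourierChar (-(x * a)) : ℂ) * (𝓕 φ : 𝓢(ℝ, ℂ)) x := by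
    simp only [SchwartzMap.fourier_coe, Real.fourier_eq]
    rw [← integral_add_right_eq_self (μ := (volume : Measure ℝ)) _ a, ← integral_const_mul]
    refine integral_congr_ae (Filter.Eventually.of_forall fun y => ?_)
    simp only [SchwartzMap.compSubConstCLM_apply, add_sub_cancel_right, Circle.smul_def,
      smul_eq_mul]
    rw [← mul_assoc, ← Circle.coe_mul, ← AddChar.map_add_eq_mul]
    congr 3
    simp
    ring
  rw [h3]
  simp only [smul_eq_mul]
  ring

/-- `𝓕 (u * conj h) ξ = ∫ 𝓕 u (η + ξ) * conj (𝓕 h η) dη` for `u, h` in `L²`. -/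
theorem fourier_mul_conj (u h : L2) (ξ : ℝ) :
    𝓕 (fun x : ℝ => u x * conj (h x)) ξ
      = ∫ η, (𝓕 u : L2) (η + ξ) * conj ((𝓕 h : L2) η) := by
  have key := Lp.inner_fourier_eq h ((memLp_modulate u ξ).toLp _)
  rw [L2.inner_def, L2.inner_def] at key
  rw [Real.fourier_eq]
  calc _ = ∫ x, inner ℂ (h x) (((memLp_modulate u ξ).toLp _ : L2) x) := by
        refine integral_congr_ae ?_
        filter_upwards [(memLp_modulate u ξ).coeFn_toLp] with x hx
        rw [hx]
        simp [Circle.smul_def, mul_comm, mul_left_comm, mul_assoc]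
    _ = _ := key.symm
    _ = _ := by
        refine integral_congr_ae ?_
        filter_upwards [fourier_modulate u ξ] with x hx
        rw [hx]
        simp

theorem integrable_mul_conj (u h : L2) : Integrable (fun x : ℝ => u x * conj (h x)) :=
  (Lp.memLp u).integrable_mul (Lp.memLp h).star

theorem memLp_szegoSpectrum {u : L2} (hu : u ∈ hardySobolev (1 / 2)) (h : hardySpace) :
    MemLp (szegoSpectrum fun x : ℝ => u x * conj ((h : L2) x)) 2 (volume : Measure ℝ) := by
  have hcont := continuous_fourier (integrable_mul_conj u h)
  have hmu : AEMeasurable (fun ζ => ‖(𝓕 u : L2) ζ‖ₑ) volume :=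
    (Lp.aestronglyMeasurable (𝓕 u : L2)).enorm
  have hmh : AEMeasurable (fun ζ => ‖(𝓕 (h : L2) : L2) ζ‖ₑ) volume :=
    (Lp.aestronglyMeasurable (𝓕 (h : L2) : L2)).enorm
  have hh : ∀ᵐ ξ : ℝ, ξ < 0 → (𝓕 (h : L2) : L2) ξ = 0 := h.2
  set K : ℝ≥0∞ := ∫⁻ η, ‖(𝓕 (h : L2) : L2) η‖ₑ ^ 2 with hK
  have hKfin : K < ∞ := by
    have := lintegral_rpow_enorm_lt_top_of_eLpNorm_lt_top (p := 2) (by norm_num) (by norm_num)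
      (Lp.memLp (𝓕 (h : L2) : L2)).2
    simpa using this
  have hbound : ∀ ξ : ℝ, 0 ≤ ξ →
      ‖𝓕 (fun x : ℝ => u x * conj ((h : L2) x)) ξ‖ₑ ^ 2
        ≤ (∫⁻ ζ, (Set.Ici ξ).indicator (fun ζ => ‖(𝓕 u : L2) ζ‖ₑ ^ 2) ζ) * K := by
    intro ξ hξ
    rw [fourier_mul_conj]
    have hmu' : AEMeasurable (fun η => ‖(𝓕 u : L2) (η + ξ)‖ₑ) volume :=
      hmu.comp_quasiMeasurePreserving
        (measurePreserving_add_right volume ξ).quasiMeasurePreserving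
    have e1 : ‖∫ η, (𝓕 u : L2) (η + ξ) * conj ((𝓕 (h : L2) : L2) η)‖ₑ
        ≤ ∫⁻ η, ((Set.Ici 0).indicator (fun η => ‖(𝓕 u : L2) (η + ξ)‖ₑ)
            * fun η => ‖(𝓕 (h : L2) : L2) η‖ₑ) η := by
      refine (enorm_integral_le_lintegral_enorm _).trans (lintegral_mono_ae ?_)
      filter_upwards [hh] with η hη
      by_cases h0 : 0 ≤ η
      · simp [Set.indicator_of_mem (show η ∈ Set.Ici (0 : ℝ) from h0)]
      · simp [hη (lt_of_not_ge h0)]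
    have e2 := ENNReal.lintegral_mul_le_Lp_mul_Lq (volume : Measure ℝ) Real.HolderConjugate.two_two
      (hmu'.indicator (measurableSet_Ici (a := (0 : ℝ)))) hmh
    have e3 := e1.trans e2
    have e4 : (∫⁻ η, ((Set.Ici 0).indicator (fun η => ‖(𝓕 u : L2) (η + ξ)‖ₑ) η) ^ (2 : ℝ))
        = ∫⁻ ζ, (Set.Ici ξ).indicator (fun ζ => ‖(𝓕 u : L2) ζ‖ₑ ^ 2) ζ := by
      rw [← lintegral_add_right_eq_self
        (fun ζ => (Set.Ici ξ).indicator (fun ζ => ‖(𝓕 u : L2) ζ‖ₑ ^ 2) ζ) ξ]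
      refine lintegral_congr fun η => ?_
      by_cases h0 : 0 ≤ η
      · simp [Set.indicator, h0]
      · simp [Set.indicator, h0]
    have e5 : (∫⁻ η, ‖(𝓕 (h : L2) : L2) η‖ₑ ^ (2 : ℝ)) = K := by simp [hK]
    rw [e4, e5, ← ENNReal.mul_rpow_of_nonneg _ _ (by norm_num)] at e3
    calc _ ≤ (((∫⁻ ζ, (Set.Ici ξ).indicator (fun ζ => ‖(𝓕 u : L2) ζ‖ₑ ^ 2) ζ) * K)
          ^ (1 / (2 : ℝ))) ^ 2 := by gcongr
      _ = _ := by
        rw [← ENNReal.rpow_natCast, ← ENNReal.rpow_mul]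
        norm_num
  have hS : ∫⁻ ξ in Set.Ici (0 : ℝ),
      (∫⁻ ζ, (Set.Ici ξ).indicator (fun ζ => ‖(𝓕 u : L2) ζ‖ₑ ^ 2) ζ) < ∞ := by
    have hsw : ∫⁻ ξ in Set.Ici (0 : ℝ),
        (∫⁻ ζ, (Set.Ici ξ).indicator (fun ζ => ‖(𝓕 u : L2) ζ‖ₑ ^ 2) ζ)
        = ∫⁻ ζ, ∫⁻ ξ in Set.Ici (0 : ℝ),
            (Set.Ici ξ).indicator (fun ζ => ‖(𝓕 u : L2) ζ‖ₑ ^ 2) ζ := by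
      refine lintegral_lintegral_swap ?_
      have hg : AEMeasurable (fun p : ℝ × ℝ => ‖(𝓕 u : L2) p.2‖ₑ ^ 2)
          ((volume.restrict (Set.Ici (0 : ℝ))).prod volume) :=
        (hmu.pow_const 2).comp_quasiMeasurePreserving Measure.quasiMeasurePreserving_snd
      exact hg.indicator (s := {p : ℝ × ℝ | p.1 ≤ p.2})
        (measurableSet_le measurable_fst measurable_snd)
    rw [hsw]
    refine lt_of_le_of_lt ?_ hu.2
    rw [← lintegral_indicator measurableSet_Ici]
    refine lintegral_mono fun ζ => ?_
    have e6 : (∫⁻ ξ in Set.Ici (0 : ℝ),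
        (Set.Ici ξ).indicator (fun ζ => ‖(𝓕 u : L2) ζ‖ₑ ^ 2) ζ)
        = ‖(𝓕 u : L2) ζ‖ₑ ^ 2 * ENNReal.ofReal ζ := by
      have : ∀ ξ, (Set.Ici ξ).indicator (fun ζ => ‖(𝓕 u : L2) ζ‖ₑ ^ 2) ζ
          = (Set.Iic ζ).indicator (fun _ => ‖(𝓕 u : L2) ζ‖ₑ ^ 2) ξ := fun ξ => by
        simp [Set.indicator]
      simp only [this]
      rw [lintegral_indicator_const measurableSet_Iic, Measure.restrict_apply measurableSet_Iic,
        Set.Iic_inter_Ici, Real.volume_Icc, sub_zero]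
    rw [e6]
    by_cases h0 : 0 ≤ ζ
    · rw [Set.indicator_of_mem (show ζ ∈ Set.Ici (0 : ℝ) from h0), mul_comm]
      gcongr
      rw [← Real.sqrt_eq_rpow]
      refine Real.le_sqrt_of_sq_le ?_
      rw [sq_abs]
      nlinarith [Real.pi_gt_three, sq_nonneg ζ, mul_nonneg (sq_nonneg ζ)
        (sub_nonneg.2 (by nlinarith [Real.pi_gt_three] : (1 : ℝ) ≤ Real.pi ^ 2))]
    · rw [ENNReal.ofReal_of_nonpos (le_of_not_ge h0), mul_zero]
      exact zero_le
  refine ⟨(hcont.aestronglyMeasurable.indicator measurableSet_Ici), ?_⟩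
  rw [eLpNorm_lt_top_iff_lintegral_rpow_enorm_lt_top (by norm_num) (by norm_num)]
  calc _ = ∫⁻ ξ in Set.Ici (0 : ℝ), ‖𝓕 (fun x : ℝ => u x * conj ((h : L2) x)) ξ‖ₑ ^ 2 := by
        rw [← lintegral_indicator measurableSet_Ici]
        refine lintegral_congr fun ξ => ?_
        by_cases h0 : 0 ≤ ξ <;> simp [szegoSpectrum, Set.indicator, h0]
    _ ≤ ∫⁻ ξ in Set.Ici (0 : ℝ),
          (∫⁻ ζ, (Set.Ici ξ).indicator (fun ζ => ‖(𝓕 u : L2) ζ‖ₑ ^ 2) ζ) * K :=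
        setLIntegral_mono' measurableSet_Ici fun ξ hξ => hbound ξ hξ
    _ = (∫⁻ ξ in Set.Ici (0 : ℝ),
          (∫⁻ ζ, (Set.Ici ξ).indicator (fun ζ => ‖(𝓕 u : L2) ζ‖ₑ ^ 2) ζ)) * K :=
        lintegral_mul_const' _ _ hKfin.ne
    _ < ∞ := ENNReal.mul_lt_top hS hKfin

/-- The Hankel operator `H_u h = Π (u * conj h)` on `L²₊(ℝ)` with symbol `u ∈ H^{1/2}₊(ℝ)`; it is
antilinear over `ℂ`. -/
def hankel (u : L2) (hu : u ∈ hardySobolev (1 / 2)) : hardySpace →ₛₗ[starRingEnd ℂ] hardySpace where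
  toFun h := szegoProj (fun x : ℝ => u x * conj ((h : L2) x)) (memLp_szegoSpectrum hu h)
  map_add' := by
    intro h k
    refine szegoProj_add ?_ (integrable_mul_conj u h) (integrable_mul_conj u k) _ _ _
    filter_upwards [Lp.coeFn_add (h : L2) (k : L2)] with x hx
    rw [Submodule.coe_add, hx, Pi.add_apply, map_add, mul_add]
  map_smul' := by
    intro c h
    refine szegoProj_smul ?_ _ _
    filter_upwards [Lp.coeFn_smul c (h : L2)] with x hx
    rw [Submodule.coe_smul, hx, Pi.smul_apply, smul_eq_mul, map_mul]
    ring

/-! ### Rational fractions -/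

/-- `A / B` is a reduced rational fraction with `deg A ≤ N - 1`, `deg B = N`, `B(0) = 1`,
and without poles in the closed upper half-plane. -/
def IsFraction (N : ℕ) (A B : ℂ[X]) : Prop :=
  A ≠ 0 ∧ A.natDegree ≤ N - 1 ∧ B.natDegree = N ∧ B.eval 0 = 1 ∧
    (∀ z : ℂ, 0 ≤ z.im → B.eval z ≠ 0) ∧ IsCoprime A B

/-- The set `M(N)` of rational fractions, as functions on the real line (boundary values). -/
def fractions (N : ℕ) : Set (ℝ → ℂ) :=
  {f | ∃ A B : ℂ[X], IsFraction N A B ∧ f = fun x : ℝ => A.eval (x : ℂ) / B.eval (x : ℂ)}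

/-- `u ∈ L²(ℝ)` belongs to `M(N)`, i.e. it is (the class of) a function in `M(N)`. -/
def MemFractions (N : ℕ) (u : L2) : Prop := ∃ f ∈ fractions N, u =ᵐ[volume] f

end Szego

end

noncomputable section

namespace Szego

/-! ### Simple fractions and their Fourier transforms -/

/-! On the Fourier side, for `ξ ≥ 0`, the transform of `H_u h` at `ξ` is the integral over `η ≥ 0`
of `û(η + ξ)` times the conjugate of `ĥ(η)`. A simple fraction `1 / (x - p) ^ (n + 1)` with `Im p <
0` has transform proportional to `ξ ^ n * exp (-2πi p ξ)` on the half-line. The exponential is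
multiplicative and `(η + ξ) ^ n` expands binomially, so the kernel separates variables
(`halfLineExp_add`). For `u = A / B` with `deg A < deg B` and no poles in the closed upper
half-plane, partial fractions then place the range of `H_u` inside `poleSpace B`, of dimension at
most `deg B`.

The reverse bound tests `H_u` on `h_n = 1 / (x + i) ^ (n + 1)`. The same binomial expansion, applied
to negative frequencies, gives `H_u h_n = (u - P_n) / (x - i) ^ (n + 1)` with `P_n` a polynomial
(`hankel_simpleFraction`). If the rank is `d`, the images of `h_0, ..., h_d` are linearly dependent,
and clearing denominators gives `u Q = P` with `Q ≠ 0` and `deg Q ≤ d` (`exists_denominator`). When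
`u = A / B` is reduced, `B` divides `Q`, hence `deg B ≤ d`: the range is all of `poleSpace B` and
the rank is `deg B` (`range_hankel_of_fraction`).

Conversely, finite rank makes `u` rational by the same argument. Square integrability excludes real
poles and forces decay at infinity; membership in the Hardy space excludes poles in the upper
half-plane, since their fractions carry only negative frequencies (`fraction_of_mem_hardySpace`).
The rank then identifies the degree of the reduced denominator. -/

theorem norm_pow_mul_cexp (r : ℂ) (n : ℕ) {t : ℝ} (ht : 0 ≤ t) :
    ‖(t : ℂ) ^ n * Complex.exp (-r * t)‖ = t ^ n * Real.exp (-r.re * t) := by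
  rw [norm_mul, norm_pow, Complex.norm_real, Real.norm_of_nonneg ht, Complex.norm_exp]
  simp

theorem integrableOn_pow_mul_cexp {r : ℂ} (hr : 0 < r.re) (n : ℕ) :
    IntegrableOn (fun t : ℝ => (t : ℂ) ^ n * Complex.exp (-r * t)) (Set.Ioi 0) := by
  have h := integrableOn_rpow_mul_exp_neg_mul_rpow (p := 1) (s := n) (b := r.re)
    (by have : (0 : ℝ) ≤ n := n.cast_nonneg
        linarith) one_pos hr
  refine Integrable.mono' h (by fun_prop) ?_
  refine (ae_restrict_iff' measurableSet_Ioi).2 (Filter.Eventually.of_forall fun t ht => ?_)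
  rw [norm_pow_mul_cexp r n (le_of_lt ht), Real.rpow_one, Real.rpow_natCast]

theorem tendsto_pow_mul_cexp {r : ℂ} (hr : 0 < r.re) (n : ℕ) :
    Filter.Tendsto (fun t : ℝ => (t : ℂ) ^ n * Complex.exp (-r * t)) Filter.atTop (nhds 0) := by
  rw [tendsto_zero_iff_norm_tendsto_zero]
  refine (tendsto_rpow_mul_exp_neg_mul_atTop_nhds_zero n r.re hr).congr' ?_
  filter_upwards [Filter.eventually_ge_atTop 0] with t ht
  rw [norm_pow_mul_cexp r n ht, Real.rpow_natCast]

/-- The Laplace transform of a power. -/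
theorem integral_pow_mul_cexp {r : ℂ} (hr : 0 < r.re) (n : ℕ) :
    ∫ t : ℝ in Set.Ioi 0, (t : ℂ) ^ n * Complex.exp (-r * t) = n.factorial / r ^ (n + 1) := by
  have hr0 : r ≠ 0 := fun h => by simp [h] at hr
  have hexp : ∀ t : ℝ, HasDerivAt (fun t : ℝ => Complex.exp (-r * t))
      (Complex.exp (-r * t) * -r) t := fun t => by
    have h1 : HasDerivAt (fun z : ℂ => Complex.exp (-r * z)) (Complex.exp (-r * t) * (-r * 1)) t :=
      ((hasDerivAt_id (t : ℂ)).const_mul (-r)).cexp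
    simpa using h1.comp_ofReal
  induction n with
  | zero =>
    have h := integral_Ioi_of_hasDerivAt_of_tendsto' (a := 0) (fun t _ => hexp t)
      (by simpa only [pow_zero, one_mul, IntegrableOn] using
        Integrable.mul_const (integrableOn_pow_mul_cexp hr 0) (-r))
      (by simpa using tendsto_pow_mul_cexp hr 0)
    rw [integral_mul_const] at h
    simp only [pow_zero, one_mul, Nat.factorial_zero, Nat.cast_one, zero_add, pow_one]
    rw [eq_div_iff hr0]
    simpa using h
  | succ n ih =>
    -- Integrating this derivative gives `0 = (n + 1) I_n - r I_{n+1}`; the boundary term at `0`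
    -- vanishes because the exponent `n + 1` is positive.
    have hd : ∀ t : ℝ, HasDerivAt (fun t : ℝ => (t : ℂ) ^ (n + 1) * Complex.exp (-r * t))
        ((n + 1) * ((t : ℂ) ^ n * Complex.exp (-r * t))
          - r * ((t : ℂ) ^ (n + 1) * Complex.exp (-r * t))) t := fun t => by
      have h1 : HasDerivAt (fun t : ℝ => (t : ℂ) ^ (n + 1)) ((n + 1 : ℕ) * (t : ℂ) ^ n) t := by
        simpa using (hasDerivAt_pow (n + 1) (t : ℂ)).comp_ofReal
      convert! h1.mul (hexp t) using 1
      push_cast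
      ring
    have i1 := (integrableOn_pow_mul_cexp hr n).const_mul ((n : ℂ) + 1)
    have i2 := (integrableOn_pow_mul_cexp hr (n + 1)).const_mul r
    have h := integral_Ioi_of_hasDerivAt_of_tendsto' (a := 0) (fun t _ => hd t)
      (i1.sub i2) (tendsto_pow_mul_cexp hr (n + 1))
    rw [integral_sub i1 i2, integral_const_mul, integral_const_mul, ih] at h
    simp only [Complex.ofReal_zero, ne_eq, Nat.add_eq_zero_iff, one_ne_zero, and_false,
      not_false_eq_true, zero_pow, zero_mul, sub_zero] at h
    rw [eq_div_iff (pow_ne_zero _ hr0), Nat.factorial_succ]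
    have h2 := (sub_eq_zero.1 h).symm
    rw [← mul_div_assoc, eq_div_iff (pow_ne_zero _ hr0)] at h2
    push_cast
    rw [← h2]
    ring

/-- The Fourier transform of a multiple of `1 / (x - p) ^ (n + 1)`, for `p` in the lower
half-plane. -/
def halfLineExp (p : ℂ) (n : ℕ) : ℝ → ℂ :=
  (Set.Ici (0 : ℝ)).indicator fun ξ => (ξ : ℂ) ^ n * Complex.exp (-(2 * Real.pi * Complex.I * p) * ξ)

theorem re_two_pi_I_mul (p : ℂ) : (2 * Real.pi * Complex.I * p).re = -(2 * Real.pi * p.im) := by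
  simp

theorem halfLineExp_of_nonneg (p : ℂ) (n : ℕ) {ξ : ℝ} (h : 0 ≤ ξ) :
    halfLineExp p n ξ = (ξ : ℂ) ^ n * Complex.exp (-(2 * Real.pi * Complex.I * p) * ξ) :=
  Set.indicator_of_mem (s := Set.Ici (0 : ℝ)) h _

theorem halfLineExp_of_neg (p : ℂ) (n : ℕ) {ξ : ℝ} (h : ξ < 0) : halfLineExp p n ξ = 0 :=
  Set.indicator_of_notMem (by simpa using h) _

theorem integrable_halfLineExp {p : ℂ} (hp : p.im < 0) (n : ℕ) : Integrable (halfLineExp p n) := by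
  rw [halfLineExp, integrable_indicator_iff measurableSet_Ici, integrableOn_Ici_iff_integrableOn_Ioi]
  refine integrableOn_pow_mul_cexp ?_ n
  rw [re_two_pi_I_mul]
  nlinarith [Real.pi_pos]

/-- The squared modulus is the modulus of the same kind of function with `2 * p` and `2 * n`, so
integrability suffices. -/
theorem memLp_halfLineExp {p : ℂ} (hp : p.im < 0) (n : ℕ) :
    MemLp (halfLineExp p n) 2 (volume : Measure ℝ) := by
  refine (memLp_two_iff_integrable_sq_norm (integrable_halfLineExp hp n).1).2 ?_
  have hp2 : (2 * p).im < 0 := by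
    simp
    linarith
  refine (integrable_halfLineExp hp2 (2 * n)).norm.congr (Filter.Eventually.of_forall fun ξ => ?_)
  change ‖halfLineExp (2 * p) (2 * n) ξ‖ = ‖halfLineExp p n ξ‖ ^ 2
  rw [← norm_pow]
  rcases lt_or_ge ξ 0 with h | h
  · simp [halfLineExp_of_neg _ _ h]
  · rw [halfLineExp_of_nonneg _ _ h, halfLineExp_of_nonneg _ _ h, mul_pow, ← Complex.exp_nat_mul,
      ← pow_mul, mul_comm n]
    congr 3
    push_cast
    ring

theorem sub_ne_zero_of_im_ne_zero {p : ℂ} (hp : p.im ≠ 0) (x : ℝ) : (x : ℂ) - p ≠ 0 := fun h =>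
  hp (by simpa using congrArg Complex.im h)

/-- This is the Laplace transform at `r = -2πi (x - p)`, whose real part `-2π Im p` is positive. -/
theorem fourierInv_halfLineExp {p : ℂ} (hp : p.im < 0) (n : ℕ) (x : ℝ) :
    𝓕⁻ (halfLineExp p n) x
      = (n.factorial / (-(2 * Real.pi * Complex.I)) ^ (n + 1)) * (1 / ((x : ℂ) - p) ^ (n + 1)) := by
  have hr : 0 < (-(2 * Real.pi * Complex.I) * ((x : ℂ) - p)).re := by
    simp
    nlinarith [Real.pi_pos]
  rw [Real.fourierInv_eq]
  calc _ = ∫ ξ, (Set.Ici (0 : ℝ)).indicator (fun ξ : ℝ => (ξ : ℂ) ^ n *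
        Complex.exp (-(-(2 * Real.pi * Complex.I) * ((x : ℂ) - p)) * ξ)) ξ := by
        refine integral_congr_ae (Filter.Eventually.of_forall fun ξ => ?_)
        rcases lt_or_ge ξ 0 with h | h
        · simp [halfLineExp_of_neg _ _ h, h]
        · rw [Set.indicator_of_mem (show ξ ∈ Set.Ici (0 : ℝ) from h)]
          simp only [halfLineExp_of_nonneg _ _ h, Circle.smul_def, Real.fourierChar_apply,
            smul_eq_mul]
          rw [mul_left_comm, ← Complex.exp_add]
          congr 2
          simp
          ring
    _ = _ := by
      rw [integral_indicator measurableSet_Ici, integral_Ici_eq_integral_Ioi,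
        integral_pow_mul_cexp hr, mul_pow]
      have := pow_ne_zero (n + 1) (sub_ne_zero_of_im_ne_zero hp.ne x)
      field_simp

/-- For `f` integrable and square integrable, the inverse Fourier integral of `f` is
(the class of) a square integrable function with Fourier transform `f`. -/
theorem exists_fourier_ae_eq {f : ℝ → ℂ} (h1 : Integrable f) (h2 : MemLp f 2 volume) :
    ∃ e : L2, e =ᵐ[volume] 𝓕⁻ f ∧ (𝓕 e : L2) =ᵐ[volume] f := by
  have hmp := Measure.measurePreserving_neg (volume : Measure ℝ)
  have h1' : Integrable fun x => f (-x) := h1.comp_neg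
  have h2' : MemLp (fun x => f (-x)) 2 volume := h2.comp_measurePreserving hmp
  have he := fourier_toLp_ae_eq _ h1' h2'
  rw [← Real.fourierInv_eq_fourier_comp_neg] at he
  refine ⟨_, he, fourier_ae_eq_of_test _ _ h1.locallyIntegrable fun φ => ?_⟩
  have e1 : ∫ x, (𝓕 φ : 𝓢(ℝ, ℂ)) x • (𝓕 (h2'.toLp _) : L2) x
      = ∫ x, (𝓕 φ : 𝓢(ℝ, ℂ)) x • 𝓕 (fun x => f (-x)) x := by
    refine integral_congr_ae ?_
    filter_upwards [he] with x hx
    rw [hx, Real.fourierInv_eq_fourier_comp_neg]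
  have e2 := VectorFourier.integral_fourierIntegral_smul_eq_flip (L := innerₗ ℝ) (μ := volume)
    (ν := volume) (f := (𝓕 φ : 𝓢(ℝ, ℂ))) (g := fun x => f (-x)) Real.continuous_fourierChar
    continuous_inner (𝓕 φ : 𝓢(ℝ, ℂ)).integrable h1'
  simp only [flip_innerₗ] at e2
  rw [e1]
  refine Eq.trans ?_ e2
  -- After moving the transform onto the test function, the double transform `𝓕 (𝓕 φ)` is `φ`
  -- reflected; the substitution `x ↦ -x` undoes this reflection.
  rw [← integral_neg_eq_self]
  refine integral_congr_ae (Filter.Eventually.of_forall fun x => ?_)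
  change _ = 𝓕 ((𝓕 φ : 𝓢(ℝ, ℂ)) : ℝ → ℂ) x • f (-x)
  have h3 : (𝓕⁻ (𝓕 φ : 𝓢(ℝ, ℂ)) : 𝓢(ℝ, ℂ)) (-x) = φ (-x) := by simp
  rw [SchwartzMap.fourierInv_coe, Real.fourierInv_eq_fourier_neg, neg_neg] at h3
  rw [h3]

theorem exists_simpleFraction {p : ℂ} (hp : p.im < 0) (n : ℕ) :
    ∃ e : L2, (e =ᵐ[volume] fun x : ℝ => 1 / ((x : ℂ) - p) ^ (n + 1)) ∧
      ∃ c : ℂ, c ≠ 0 ∧ (𝓕 e : L2) =ᵐ[volume] fun ξ => c * halfLineExp p n ξ := by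
  obtain ⟨e, he, hf⟩ := exists_fourier_ae_eq (integrable_halfLineExp hp n) (memLp_halfLineExp hp n)
  have hc : (n.factorial / (-(2 * Real.pi * Complex.I)) ^ (n + 1) : ℂ) ≠ 0 := by
    have := Nat.factorial_ne_zero n
    simp [this, Real.pi_ne_zero]
  set c : ℂ := n.factorial / (-(2 * Real.pi * Complex.I)) ^ (n + 1)
  refine ⟨c⁻¹ • e, ?_, c⁻¹, inv_ne_zero hc, ?_⟩
  · filter_upwards [he, Lp.coeFn_smul c⁻¹ e] with x h1 h2
    rw [h2, Pi.smul_apply, h1, fourierInv_halfLineExp hp, smul_eq_mul, inv_mul_cancel_left₀ hc]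
  · rw [FourierTransform.fourier_smul]
    filter_upwards [hf, Lp.coeFn_smul c⁻¹ (𝓕 e : L2)] with x h1 h2
    rw [h2, Pi.smul_apply, h1, smul_eq_mul]

/-- The reflection `x ↦ -x` sends the pole `p` to `-p` in the lower half-plane, at the cost of a
sign `(-1) ^ (n + 1)`; the spectrum moves to the negative half-line. -/
theorem exists_simpleFraction_upper {p : ℂ} (hp : 0 < p.im) (n : ℕ) :
    ∃ e : L2, (e =ᵐ[volume] fun x : ℝ => 1 / ((x : ℂ) - p) ^ (n + 1)) ∧
      ∃ c : ℂ, c ≠ 0 ∧ (𝓕 e : L2) =ᵐ[volume] fun ξ => c * halfLineExp (-p) n (-ξ) := by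
  have hp' : (-p).im < 0 := by simpa using hp
  have hmp := Measure.measurePreserving_neg (volume : Measure ℝ)
  obtain ⟨e, he, hf⟩ := exists_fourier_ae_eq (integrable_halfLineExp hp' n).comp_neg
    ((memLp_halfLineExp hp' n).comp_measurePreserving hmp)
  have hc : ((-1) ^ (n + 1) * (n.factorial / (-(2 * Real.pi * Complex.I)) ^ (n + 1)) : ℂ) ≠ 0 := by
    have := Nat.factorial_ne_zero n
    simp [this, Real.pi_ne_zero]
  set c : ℂ := (-1) ^ (n + 1) * (n.factorial / (-(2 * Real.pi * Complex.I)) ^ (n + 1)) with hcdef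
  refine ⟨c⁻¹ • e, ?_, c⁻¹, inv_ne_zero hc, ?_⟩
  · filter_upwards [he, Lp.coeFn_smul c⁻¹ e] with x h1 h2
    have h3 : 𝓕⁻ (fun ξ => halfLineExp (-p) n (-ξ)) x = c * (1 / ((x : ℂ) - p) ^ (n + 1)) := by
      rw [Real.fourierInv_eq_fourier_comp_neg]
      simp only [neg_neg]
      rw [← neg_neg x, ← Real.fourierInv_eq_fourier_neg, fourierInv_halfLineExp hp', hcdef, neg_neg]
      have e1 : ((-x : ℝ) : ℂ) - -p = (-1) * (x - p) := by
        push_cast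
        ring
      rw [e1, mul_pow]
      have h4 : ((-1 : ℂ) ^ (n + 1)) * (-1) ^ (n + 1) = 1 := by
        rw [← mul_pow]
        simp
      rw [one_div, mul_inv, ← eq_inv_of_mul_eq_one_left h4, one_div]
      ring
    rw [h2, Pi.smul_apply, h1, smul_eq_mul, h3, inv_mul_cancel_left₀ hc]
  · rw [FourierTransform.fourier_smul]
    filter_upwards [hf, Lp.coeFn_smul c⁻¹ (𝓕 e : L2)] with x h1 h2
    rw [h2, Pi.smul_apply, h1, smul_eq_mul]

/-! ### Functions represented by, and spectra of, elements of a subspace of `L²` -/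

/-- The functions which represent an element of `W`. -/
def representatives (W : Submodule ℂ L2) : Submodule ℂ (ℝ → ℂ) where
  carrier := {f | ∃ w ∈ W, w =ᵐ[volume] f}
  zero_mem' := ⟨0, W.zero_mem, Lp.coeFn_zero ℂ 2 volume⟩
  add_mem' := by
    rintro f g ⟨v, hv, hf⟩ ⟨w, hw, hg⟩
    exact ⟨v + w, W.add_mem hv hw, (Lp.coeFn_add v w).trans (hf.add hg)⟩
  smul_mem' := by
    rintro c f ⟨v, hv, hf⟩
    exact ⟨c • v, W.smul_mem c hv, (Lp.coeFn_smul c v).trans (hf.const_smul c)⟩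

/-- The functions which represent the Fourier transform of an element of `W`. -/
def spectra (W : Submodule ℂ L2) : Submodule ℂ (ℝ → ℂ) where
  carrier := {f | ∃ w ∈ W, (𝓕 w : L2) =ᵐ[volume] f}
  zero_mem' := ⟨0, W.zero_mem, by
    rw [show (𝓕 (0 : L2) : L2) = 0 from (Lp.fourierTransformₗᵢ ℝ ℂ).map_zero]
    exact Lp.coeFn_zero ℂ 2 volume⟩
  add_mem' := by
    rintro f g ⟨v, hv, hf⟩ ⟨w, hw, hg⟩
    refine ⟨v + w, W.add_mem hv hw, ?_⟩
    rw [FourierTransform.fourier_add]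
    exact (Lp.coeFn_add _ _).trans (hf.add hg)
  smul_mem' := by
    rintro c f ⟨v, hv, hf⟩
    refine ⟨c • v, W.smul_mem c hv, ?_⟩
    rw [FourierTransform.fourier_smul]
    exact (Lp.coeFn_smul _ _).trans (hf.const_smul c)

theorem spectra_congr {W : Submodule ℂ L2} {f g : ℝ → ℂ} (hf : f ∈ spectra W)
    (h : f =ᵐ[volume] g) : g ∈ spectra W := by
  obtain ⟨w, hw, e⟩ := hf
  exact ⟨w, hw, e.trans h⟩

theorem eq_of_fourier_ae_eq {v w : L2} (h : (𝓕 v : L2) =ᵐ[volume] (𝓕 w : L2)) : v = w :=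
  (Lp.fourierTransformₗᵢ ℝ ℂ).injective (Lp.ext h)

/-! ### The space `H^{1/2}₊` -/

/-- `H^{1/2}₊(ℝ)` as a subspace of `L²(ℝ)`. -/
def hardySobolevHalf : Submodule ℂ L2 where
  carrier := hardySobolev (1 / 2)
  zero_mem' := by
    refine ⟨hardySpace.zero_mem, ?_⟩
    rw [show (𝓕 (0 : L2) : L2) = 0 from (Lp.fourierTransformₗᵢ ℝ ℂ).map_zero]
    simp
  add_mem' := by
    intro f g hf hg
    refine ⟨hardySpace.add_mem hf.1 hg.1, ?_⟩
    rw [FourierTransform.fourier_add]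
    have hm : AEMeasurable (fun ξ => ENNReal.ofReal ((1 + |2 * Real.pi * ξ| ^ 2) ^ (1 / 2 : ℝ)) *
        ‖(𝓕 f : L2) ξ‖ₑ ^ 2) (volume.restrict (Set.Ici (0 : ℝ))) := by
      have h1 := (Lp.aestronglyMeasurable (𝓕 f : L2)).enorm.restrict (s := Set.Ici (0 : ℝ))
      exact (Measurable.aemeasurable (by fun_prop)).mul (h1.pow_const 2)
    -- The factor `2` comes from `|a + b|² ≤ 2 (|a|² + |b|²)`.
    have hfin := ENNReal.mul_lt_top (ENNReal.ofNat_lt_top (n := 2)) (ENNReal.add_lt_top.2 ⟨hf.2, hg.2⟩)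
    rw [← lintegral_add_left' hm, ← lintegral_const_mul' _ _ ENNReal.ofNat_ne_top] at hfin
    refine lt_of_le_of_lt (lintegral_mono_ae ?_) hfin
    filter_upwards [ae_restrict_of_ae (Lp.coeFn_add (𝓕 f : L2) (𝓕 g : L2))] with ξ hξ
    rw [hξ, Pi.add_apply, ← mul_add, mul_left_comm]
    gcongr
    have h2 := ENNReal.rpow_add_le_mul_rpow_add_rpow ‖(𝓕 f : L2) ξ‖ₑ ‖(𝓕 g : L2) ξ‖ₑ
      (p := 2) (by norm_num)
    norm_num at h2
    exact le_trans (by gcongr; exact enorm_add_le _ _) h2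
  smul_mem' := by
    intro c f hf
    refine ⟨hardySpace.smul_mem c hf.1, ?_⟩
    rw [FourierTransform.fourier_smul]
    have hfin := ENNReal.mul_lt_top (a := ‖c‖ₑ ^ 2) (by simp) hf.2
    rw [← lintegral_const_mul' _ _ (by simp)] at hfin
    refine lt_of_le_of_lt (lintegral_mono_ae ?_) hfin
    filter_upwards [ae_restrict_of_ae (Lp.coeFn_smul c (𝓕 f : L2))] with ξ hξ
    rw [hξ, Pi.smul_apply, enorm_smul, mul_pow, mul_left_comm]

theorem mem_hardySpace_of_fourier {e : L2} {p c : ℂ} {n : ℕ}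
    (h : (𝓕 e : L2) =ᵐ[volume] fun ξ => c * halfLineExp p n ξ) : e ∈ hardySpace := by
  change ∀ᵐ ξ : ℝ, ξ < 0 → (𝓕 e : L2) ξ = 0
  filter_upwards [h] with ξ hξ h0
  rw [hξ, halfLineExp_of_neg _ _ h0, mul_zero]

/-- The weight `sqrt (1 + (2πξ)²)` is at most `(1 + 2πξ)²`, and multiplying the transform by `1 +
2πξ` merely adds a term with `n + 1` in place of `n`, which is still in `L²`. -/
theorem mem_hardySobolevHalf_of_fourier {e : L2} {p c : ℂ} (hp : p.im < 0) {n : ℕ}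
    (h : (𝓕 e : L2) =ᵐ[volume] fun ξ => c * halfLineExp p n ξ) : e ∈ hardySobolevHalf := by
  refine ⟨mem_hardySpace_of_fourier h, ?_⟩
  have hm : MemLp (fun ξ => c * (halfLineExp p n ξ + (2 * Real.pi : ℝ) * halfLineExp p (n + 1) ξ)) 2
      (volume : Measure ℝ) :=
    ((memLp_halfLineExp hp n).add ((memLp_halfLineExp hp (n + 1)).const_mul _)).const_mul c
  have hfin := lintegral_rpow_enorm_lt_top_of_eLpNorm_lt_top (p := 2) (by norm_num) (by norm_num)
    hm.2
  refine lt_of_le_of_lt (lintegral_mono_ae ?_) (lt_of_le_of_lt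
    (setLIntegral_le_lintegral (Set.Ici (0 : ℝ)) _) hfin)
  refine (ae_restrict_iff' measurableSet_Ici).2 ?_
  filter_upwards [h] with ξ hξ h0
  have h0' : (0 : ℝ) ≤ ξ := h0
  have e1 : halfLineExp p n ξ + (2 * Real.pi : ℝ) * halfLineExp p (n + 1) ξ
      = ((1 + 2 * Real.pi * ξ : ℝ) : ℂ) * halfLineExp p n ξ := by
    rw [halfLineExp_of_nonneg _ _ h0', halfLineExp_of_nonneg _ _ h0']
    push_cast
    ring
  have hpos : 0 ≤ 2 * Real.pi * ξ := by positivity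
  rw [hξ, e1, mul_left_comm, enorm_mul ((1 + 2 * Real.pi * ξ : ℝ) : ℂ)]
  simp only [ENNReal.toReal_ofNat, ENNReal.rpow_ofNat]
  rw [mul_pow]
  gcongr
  rw [← ofReal_norm, ← ENNReal.ofReal_pow (norm_nonneg _), Complex.norm_real,
    Real.norm_of_nonneg (by positivity)]
  refine ENNReal.ofReal_le_ofReal ?_
  rw [← Real.sqrt_eq_rpow, sq_abs]
  refine (Real.sqrt_le_left (by positivity)).2 ?_
  have h1 : (1 + 2 * Real.pi * ξ) ^ 1 ≤ (1 + 2 * Real.pi * ξ) ^ 2 :=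
    pow_le_pow_right₀ (by linarith) (by norm_num)
  nlinarith

/-! ### Spaces of rational functions with prescribed poles -/

/-- The rational functions `1 / (x - p) ^ (k + 1)` with `k` less than the multiplicity of the
root `p` of `B`. -/
def simpleFractions (B : ℂ[X]) : Submodule ℂ (ℝ → ℂ) :=
  Submodule.span ℂ {f | ∃ p k, k < B.rootMultiplicity p ∧
    f = fun x : ℝ => 1 / ((x : ℂ) - p) ^ (k + 1)}

/-- The space spanned by the classes of `1 / (x - p) ^ (k + 1)`, where `k` is less than the
multiplicity of the root `p` of `B`. -/
def poleSpace (B : ℂ[X]) : Submodule ℂ L2 :=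
  Submodule.span ℂ {e | ∃ p k, k < B.rootMultiplicity p ∧
    e =ᵐ[volume] fun x : ℝ => 1 / ((x : ℂ) - p) ^ (k + 1)}

theorem simpleFractions_mono {B C : ℂ[X]} (hC : C ≠ 0) (h : B ∣ C) :
    simpleFractions B ≤ simpleFractions C := by
  refine Submodule.span_mono ?_
  rintro f ⟨p, k, hk, rfl⟩
  exact ⟨p, k, hk.trans_le (Polynomial.rootMultiplicity_le_rootMultiplicity_of_dvd hC h p), rfl⟩

/-- Partial fraction decomposition. -/
theorem div_mem_simpleFractions {A B : ℂ[X]} (hAB : A.degree < B.degree)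
    (hB : ∀ x : ℝ, B.eval (x : ℂ) ≠ 0) :
    (fun x : ℝ => A.eval (x : ℂ) / B.eval (x : ℂ)) ∈ simpleFractions B := by
  induction hd : B.natDegree generalizing A B with
  | zero =>
    have h1 : B.degree ≤ 0 := Polynomial.natDegree_eq_zero_iff_degree_le_zero.1 hd
    have h2 : A = 0 := by
      rw [← Polynomial.degree_eq_bot]
      exact Nat.WithBot.lt_zero_iff.1 (hAB.trans_le h1)
    subst h2
    convert! Submodule.zero_mem (simpleFractions B) using 1
    funext x
    simp
  | succ d ih =>
    have hB0 : B ≠ 0 := fun h => by simp [h] at hd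
    have hdeg : B.degree ≠ 0 := fun h => by
      rw [Polynomial.natDegree_eq_zero_iff_degree_le_zero.2 h.le] at hd
      omega
    obtain ⟨p, hp⟩ := Complex.exists_root (Polynomial.degree_pos_of_ne_zero_of_nonunit hB0
      fun h => hdeg (Polynomial.degree_eq_zero_of_isUnit h))
    obtain ⟨C, hC, hCp⟩ := Polynomial.exists_eq_pow_rootMultiplicity_mul_and_not_dvd B hB0 p
    have hm : 0 < B.rootMultiplicity p := (Polynomial.rootMultiplicity_pos hB0).2 hp
    obtain ⟨m, hm'⟩ : ∃ m, B.rootMultiplicity p = m + 1 := ⟨_, (Nat.succ_pred_eq_of_pos hm).symm⟩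
    rw [hm'] at hC
    rw [Polynomial.dvd_iff_isRoot, Polynomial.IsRoot.def] at hCp
    set B' := (Polynomial.X - Polynomial.C p) ^ m * C with hB'
    have hBB' : B = (Polynomial.X - Polynomial.C p) * B' := by
      rw [hC, hB']
      ring
    have hB'0 : B' ≠ 0 := fun h => hB0 (by rw [hBB', h, mul_zero])
    have hd' : B'.natDegree = d := by
      rw [hBB', Polynomial.natDegree_mul (Polynomial.X_sub_C_ne_zero p) hB'0,
        Polynomial.natDegree_X_sub_C] at hd
      omega
    -- With this value `A - c C` vanishes at `p`, so subtracting `c / (x - p) ^ (m + 1)` cancels one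
    -- factor `X - p` of the denominator.
    set c := A.eval p / C.eval p with hc
    obtain ⟨A', hA'⟩ : Polynomial.X - Polynomial.C p ∣ A - Polynomial.C c * C := by
      rw [Polynomial.dvd_iff_isRoot, Polynomial.IsRoot.def]
      simp [hc, hCp]
    have hx : ∀ x : ℝ, ((x : ℂ) - p) ≠ 0 := fun x h => hB x (by rw [hBB']; simp [h])
    have hx' : ∀ x : ℝ, B'.eval (x : ℂ) ≠ 0 := fun x h => hB x (by rw [hBB']; simp [h])
    have hA'B' : A'.degree < B'.degree := by
      have h1 : (A - Polynomial.C c * C).degree < B.degree := by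
        refine lt_of_le_of_lt (Polynomial.degree_sub_le _ _) (max_lt hAB ?_)
        rw [Polynomial.C_mul']
        refine lt_of_le_of_lt (Polynomial.degree_smul_le _ _) ?_
        have hC0 : C ≠ 0 := fun h => hCp (by simp [h])
        rw [hC, Polynomial.degree_mul, Polynomial.degree_pow, Polynomial.degree_X_sub_C,
          Polynomial.degree_eq_natDegree hC0, nsmul_one]
        exact_mod_cast (by omega : C.natDegree < m + 1 + C.natDegree)
      rw [hA', hBB', Polynomial.degree_mul, Polynomial.degree_mul] at h1
      exact lt_of_add_lt_add_left h1
    have key : (fun x : ℝ => A.eval (x : ℂ) / B.eval (x : ℂ))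
        = c • (fun x : ℝ => 1 / ((x : ℂ) - p) ^ (m + 1))
          + fun x : ℝ => A'.eval (x : ℂ) / B'.eval (x : ℂ) := by
      funext x
      have hAx := congrArg (Polynomial.eval (x : ℂ)) hA'
      simp only [Polynomial.eval_sub, Polynomial.eval_mul, Polynomial.eval_C,
        Polynomial.eval_X] at hAx
      have hBx : B'.eval (x : ℂ) = ((x : ℂ) - p) ^ m * C.eval (x : ℂ) := by simp [hB']
      have hCx : C.eval (x : ℂ) ≠ 0 := fun h => hx' x (by rw [hBx, h, mul_zero])
      have := hx x
      simp only [Pi.add_apply, Pi.smul_apply, smul_eq_mul]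
      rw [hBB', Polynomial.eval_mul, Polynomial.eval_sub, Polynomial.eval_X, Polynomial.eval_C, hBx,
        sub_eq_iff_eq_add.1 hAx]
      field_simp
      ring
    rw [key]
    refine Submodule.add_mem _ (Submodule.smul_mem _ _ (Submodule.subset_span ⟨p, m, by omega, rfl⟩))
      (simpleFractions_mono hB0 ⟨_, by rw [mul_comm, ← hBB']⟩ (ih hA'B' hx' hd'))

theorem rootMultiplicity_pos_im {B : ℂ[X]} (hB : ∀ z : ℂ, 0 ≤ z.im → B.eval z ≠ 0) {p : ℂ} {k : ℕ}
    (hk : k < B.rootMultiplicity p) : p.im < 0 := by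
  by_contra! h
  rw [Polynomial.rootMultiplicity_eq_zero (hB p h)] at hk
  omega

/-- Transfers pointwise partial fractions to classes in `L²`. Only real poles are forbidden: the
result is also needed before poles in the upper half-plane have been ruled out. -/
theorem simpleFractions_le_representatives {B : ℂ[X]} (hB : ∀ x : ℝ, B.eval (x : ℂ) ≠ 0) :
    simpleFractions B ≤ representatives (poleSpace B) := by
  refine Submodule.span_le.2 ?_
  rintro f ⟨p, k, hk, rfl⟩
  have hp : p.im ≠ 0 := fun h => by
    have h1 := hB p.re
    rw [show ((p.re : ℝ) : ℂ) = p from Complex.ext rfl (by simp [h])] at h1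
    rw [Polynomial.rootMultiplicity_eq_zero h1] at hk
    omega
  rcases lt_or_gt_of_ne hp with hp | hp
  · obtain ⟨e, he, -⟩ := exists_simpleFraction hp k
    exact ⟨e, Submodule.subset_span ⟨p, k, hk, he⟩, he⟩
  · obtain ⟨e, he, -⟩ := exists_simpleFraction_upper hp k
    exact ⟨e, Submodule.subset_span ⟨p, k, hk, he⟩, he⟩

theorem fourier_simpleFraction {p : ℂ} (hp : p.im < 0) {n : ℕ} {e : L2}
    (he : e =ᵐ[volume] fun x : ℝ => 1 / ((x : ℂ) - p) ^ (n + 1)) :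
    ∃ c : ℂ, c ≠ 0 ∧ (𝓕 e : L2) =ᵐ[volume] fun ξ => c * halfLineExp p n ξ := by
  obtain ⟨e', he', h⟩ := exists_simpleFraction hp n
  rwa [Lp.ext (he.trans he'.symm)]

theorem fourier_simpleFraction_upper {p : ℂ} (hp : 0 < p.im) {n : ℕ} {e : L2}
    (he : e =ᵐ[volume] fun x : ℝ => 1 / ((x : ℂ) - p) ^ (n + 1)) :
    ∃ c : ℂ, c ≠ 0 ∧ (𝓕 e : L2) =ᵐ[volume] fun ξ => c * halfLineExp (-p) n (-ξ) := by
  obtain ⟨e', he', h⟩ := exists_simpleFraction_upper hp n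
  rwa [Lp.ext (he.trans he'.symm)]

theorem poleSpace_le_hardySobolevHalf {B : ℂ[X]} (hB : ∀ z : ℂ, 0 ≤ z.im → B.eval z ≠ 0) :
    poleSpace B ≤ hardySobolevHalf := by
  refine Submodule.span_le.2 ?_
  rintro e ⟨p, k, hk, he⟩
  have hp := rootMultiplicity_pos_im hB hk
  obtain ⟨c, -, h⟩ := fourier_simpleFraction hp he
  exact mem_hardySobolevHalf_of_fourier hp h

/-! ### Hankel operators on rational functions -/

theorem fourier_congr_ae {f g : ℝ → ℂ} (h : f =ᵐ[volume] g) : 𝓕 f = 𝓕 g := by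
  funext ξ
  simp only [Real.fourier_eq]
  refine integral_congr_ae ?_
  filter_upwards [h] with x hx
  rw [hx]

theorem fourier_add_mul_conj (v w h : L2) :
    𝓕 (fun x : ℝ => (v + w : L2) x * conj (h x))
      = 𝓕 (fun x : ℝ => v x * conj (h x)) + 𝓕 (fun x : ℝ => w x * conj (h x)) := by
  have e : (fun x : ℝ => (v + w : L2) x * conj (h x)) =ᵐ[volume]
      fun x => v x * conj (h x) + w x * conj (h x) := by
    filter_upwards [Lp.coeFn_add v w] with x hx
    rw [hx, Pi.add_apply, add_mul]
  rw [fourier_congr_ae e]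
  funext ξ
  simp only [Pi.add_apply, Real.fourier_eq]
  rw [← integral_add ((Real.fourierIntegral_convergent_iff ξ).2 (integrable_mul_conj v h))
      ((Real.fourierIntegral_convergent_iff ξ).2 (integrable_mul_conj w h))]
  simp only [smul_add]

theorem fourier_smul_mul_conj (c : ℂ) (v h : L2) :
    𝓕 (fun x : ℝ => (c • v : L2) x * conj (h x)) = c • 𝓕 (fun x : ℝ => v x * conj (h x)) := by
  have e : (fun x : ℝ => (c • v : L2) x * conj (h x)) =ᵐ[volume]
      fun x => c * (v x * conj (h x)) := by
    filter_upwards [Lp.coeFn_smul c v] with x hx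
    rw [hx, Pi.smul_apply, smul_eq_mul, mul_assoc]
  rw [fourier_congr_ae e]
  funext ξ
  simp only [Pi.smul_apply, Real.fourier_eq, Circle.smul_def, smul_eq_mul]
  rw [← integral_const_mul]
  simp only [mul_left_comm]

/-- The separation of variables behind every finite-rank statement: a binomial expansion times a
multiplicative exponential. -/
theorem halfLineExp_add (p : ℂ) (n : ℕ) {ξ η : ℝ} (hξ : 0 ≤ ξ) (hη : 0 ≤ η) :
    halfLineExp p n (η + ξ) = ∑ l ∈ Finset.range (n + 1),
      (n.choose l : ℂ) * halfLineExp p l ξ * halfLineExp p (n - l) η := by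
  rw [halfLineExp_of_nonneg _ _ (add_nonneg hη hξ), add_comm η ξ]
  push_cast
  rw [add_pow, Finset.sum_mul]
  refine Finset.sum_congr rfl fun l _ => ?_
  rw [halfLineExp_of_nonneg _ _ hξ, halfLineExp_of_nonneg _ _ hη, mul_add, Complex.exp_add]
  ring

theorem integrable_halfLineExp_mul_conj {p : ℂ} (hp : p.im < 0) (n : ℕ) (h : L2) :
    Integrable fun η => halfLineExp p n η * conj (h η) :=
  (memLp_halfLineExp hp n).integrable_mul (Lp.memLp h).star

theorem halfLineExp_mem_spectra {B : ℂ[X]} {p : ℂ} {k : ℕ} (hp : p.im < 0)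
    (hk : k < B.rootMultiplicity p) : halfLineExp p k ∈ spectra (poleSpace B) := by
  obtain ⟨e, he, c, hc, hf⟩ := exists_simpleFraction hp k
  have h : (fun ξ => c * halfLineExp p k ξ) ∈ spectra (poleSpace B) :=
    ⟨e, Submodule.subset_span ⟨p, k, hk, he⟩, hf⟩
  have h2 := Submodule.smul_mem _ c⁻¹ h
  convert! h2 using 1
  funext ξ
  simp [hc]

/-- By linearity in the symbol, one simple fraction suffices. As `ĥ` vanishes at negative `η`, the
kernel separates, and only orders `l ≤ k` at the same pole appear. -/
theorem szegoSpectrum_mem_spectra {B : ℂ[X]} (hB : ∀ z : ℂ, 0 ≤ z.im → B.eval z ≠ 0) {v : L2}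
    (hv : v ∈ poleSpace B) (h : hardySpace) :
    szegoSpectrum (fun x : ℝ => v x * conj ((h : L2) x)) ∈ spectra (poleSpace B) := by
  induction hv using Submodule.span_induction with
  | mem e he =>
    obtain ⟨p, k, hk, he⟩ := he
    have hp := rootMultiplicity_pos_im hB hk
    obtain ⟨c, -, hf⟩ := fourier_simpleFraction hp he
    have key : szegoSpectrum (fun x : ℝ => e x * conj ((h : L2) x))
        = ∑ l ∈ Finset.range (k + 1), (c * (k.choose l : ℂ) *
          ∫ η, halfLineExp p (k - l) η * conj ((𝓕 (h : L2) : L2) η)) • halfLineExp p l := by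
      funext ξ
      rw [Finset.sum_apply]
      rcases lt_or_ge ξ 0 with h0 | h0
      · rw [szegoSpectrum, Set.indicator_of_notMem (by simpa using h0)]
        exact (Finset.sum_eq_zero fun l _ => by simp [halfLineExp_of_neg _ _ h0]).symm
      · rw [szegoSpectrum, Set.indicator_of_mem (show ξ ∈ Set.Ici (0 : ℝ) from h0),
          fourier_mul_conj]
        have e1 : ∀ᵐ η : ℝ, (𝓕 e : L2) (η + ξ) * conj ((𝓕 (h : L2) : L2) η)
            = ∑ l ∈ Finset.range (k + 1), (c * (k.choose l : ℂ) * halfLineExp p l ξ) *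
              (halfLineExp p (k - l) η * conj ((𝓕 (h : L2) : L2) η)) := by
          filter_upwards [h.2, (measurePreserving_add_right volume ξ).quasiMeasurePreserving.ae hf]
            with η h1 h2
          rcases lt_or_ge η 0 with hη | hη
          · simp [h1 hη]
          · rw [h2, halfLineExp_add p k h0 hη, Finset.mul_sum, Finset.sum_mul]
            exact Finset.sum_congr rfl fun l _ => by ring
        rw [integral_congr_ae e1, integral_finsetSum _ fun l _ =>
          (integrable_halfLineExp_mul_conj hp _ _).const_mul _]
        refine Finset.sum_congr rfl fun l _ => ?_
        rw [integral_const_mul, Pi.smul_apply, smul_eq_mul]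
        ring
    rw [key]
    refine Submodule.sum_mem _ fun l hl => Submodule.smul_mem _ _
      (halfLineExp_mem_spectra hp ?_)
    have := Finset.mem_range.1 hl
    omega
  | zero =>
    have e := fourier_smul_mul_conj 0 0 (h : L2)
    rw [zero_smul, zero_smul] at e
    rw [szegoSpectrum, e, Set.indicator_zero']
    exact Submodule.zero_mem _
  | add v w _ _ hv hw =>
    rw [szegoSpectrum, fourier_add_mul_conj, Set.indicator_add']
    exact Submodule.add_mem _ hv hw
  | smul c v _ hv =>
    rw [szegoSpectrum, fourier_smul_mul_conj]
    exact (Set.indicator_const_smul (Set.Ici (0 : ℝ)) c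
      (𝓕 fun x : ℝ => v x * conj ((h : L2) x))) ▸ Submodule.smul_mem _ c hv

theorem fourier_hankel (u : L2) (hu : u ∈ hardySobolev (1 / 2)) (h : hardySpace) :
    (𝓕 (hankel u hu h : L2) : L2) =ᵐ[volume]
      szegoSpectrum fun x : ℝ => u x * conj ((h : L2) x) := by
  have e := fourier_szegoProj _ (memLp_szegoSpectrum hu h)
  change (𝓕 (szegoProj _ (memLp_szegoSpectrum hu h) : L2) : L2) =ᵐ[volume] _
  rw [e]
  exact MemLp.coeFn_toLp _

theorem hankel_mem_poleSpace {B : ℂ[X]} (hB : ∀ z : ℂ, 0 ≤ z.im → B.eval z ≠ 0) {u : L2}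
    (hu : u ∈ hardySobolev (1 / 2)) (hv : u ∈ poleSpace B) (h : hardySpace) :
    (hankel u hu h : L2) ∈ poleSpace B := by
  obtain ⟨w, hw, e⟩ := szegoSpectrum_mem_spectra hB hv h
  rwa [eq_of_fourier_ae_eq ((fourier_hankel u hu h).trans e.symm)]

/-! ### Hankel operators applied to simple fractions -/

/-- At `p = -i` the exponential is `exp (-2πξ)`, which is real. -/
theorem conj_halfLineExp_neg_I (n : ℕ) (ξ : ℝ) :
    conj (halfLineExp (-Complex.I) n ξ) = halfLineExp (-Complex.I) n ξ := by
  rcases lt_or_ge ξ 0 with h | h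
  · simp [halfLineExp_of_neg _ _ h]
  · rw [halfLineExp_of_nonneg _ _ h, map_mul, map_pow, Complex.conj_ofReal, ← Complex.exp_conj]
    simp [Complex.conj_ofNat]

theorem exists_polynomial_of_mem_poleSpace {p : ℂ} (hp : p.im ≠ 0) {n : ℕ} {w : L2}
    (hw : w ∈ poleSpace ((Polynomial.X - Polynomial.C p) ^ n)) :
    ∃ P : ℂ[X], w =ᵐ[volume] fun x : ℝ => P.eval (x : ℂ) / ((x : ℂ) - p) ^ n := by
  induction hw using Submodule.span_induction with
  | mem e he =>
    obtain ⟨q, k, hk, he⟩ := he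
    have hq : q = p := by
      by_contra hq
      rw [Polynomial.rootMultiplicity_eq_zero] at hk
      · omega
      · simp [sub_eq_zero, hq]
    subst hq
    rw [Polynomial.rootMultiplicity_X_sub_C_pow] at hk
    refine ⟨(Polynomial.X - Polynomial.C q) ^ (n - (k + 1)), ?_⟩
    filter_upwards [he] with x hx
    have h0 := sub_ne_zero_of_im_ne_zero hp x
    rw [hx]
    simp only [Polynomial.eval_pow, Polynomial.eval_sub, Polynomial.eval_X, Polynomial.eval_C]
    rw [div_eq_div_iff (pow_ne_zero _ h0) (pow_ne_zero _ h0), one_mul, ← pow_add]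
    congr 1
    omega
  | zero =>
    refine ⟨0, ?_⟩
    filter_upwards with x
    simp
  | add v w _ _ hv hw =>
    obtain ⟨P, hP⟩ := hv
    obtain ⟨Q, hQ⟩ := hw
    refine ⟨P + Q, ?_⟩
    filter_upwards [Lp.coeFn_add v w, hP, hQ] with x hx h1 h2
    rw [hx, Pi.add_apply, h1, h2, Polynomial.eval_add, add_div]
  | smul c v _ hv =>
    obtain ⟨P, hP⟩ := hv
    refine ⟨Polynomial.C c * P, ?_⟩
    filter_upwards [Lp.coeFn_smul c v, hP] with x hx h1
    rw [hx, Pi.smul_apply, h1, Polynomial.eval_mul, Polynomial.eval_C, smul_eq_mul, mul_div_assoc]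

theorem halfLineExp_neg_mem_spectra {l n : ℕ} (hl : l < n) :
    (fun ξ : ℝ => halfLineExp (-Complex.I) l (-ξ)) ∈
      spectra (poleSpace ((Polynomial.X - Polynomial.C Complex.I) ^ n)) := by
  obtain ⟨e, he, c, hc, hf⟩ := exists_simpleFraction_upper (p := Complex.I) (by simp) l
  have h : (fun ξ => c * halfLineExp (-Complex.I) l (-ξ)) ∈
      spectra (poleSpace ((Polynomial.X - Polynomial.C Complex.I) ^ n)) :=
    ⟨e, Submodule.subset_span ⟨Complex.I, l,
      by rwa [Polynomial.rootMultiplicity_X_sub_C_pow], he⟩, hf⟩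
  have h2 := Submodule.smul_mem _ c⁻¹ h
  convert! h2 using 1
  funext ξ
  simp [hc]

/-- The negative frequencies of `u / (x - i) ^ (n + 1)` are those of a rational function with the
same denominator. -/
theorem negative_spectrum_mem {u : L2} (hu : u ∈ hardySpace) {n : ℕ} {h : L2}
    (hh : h =ᵐ[volume] fun x : ℝ => 1 / ((x : ℂ) - -Complex.I) ^ (n + 1)) :
    (Set.Iio (0 : ℝ)).indicator (𝓕 fun x : ℝ => u x * conj (h x)) ∈
      spectra (poleSpace ((Polynomial.X - Polynomial.C Complex.I) ^ (n + 1))) := by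
  have hI : (-Complex.I).im < 0 := by simp
  obtain ⟨c, -, hf⟩ := fourier_simpleFraction hI hh
  have hint : ∀ m, Integrable fun s => (𝓕 u : L2) s * halfLineExp (-Complex.I) m s := fun m =>
    (Lp.memLp (𝓕 u : L2)).integrable_mul (memLp_halfLineExp hI m)
  have key : ∀ᵐ ξ : ℝ, (∑ l ∈ Finset.range (n + 1), (conj c * (n.choose l : ℂ) *
          ∫ s, (𝓕 u : L2) s * halfLineExp (-Complex.I) (n - l) s) •
            fun ξ : ℝ => halfLineExp (-Complex.I) l (-ξ)) ξ
      = (Set.Iio (0 : ℝ)).indicator (𝓕 fun x : ℝ => u x * conj (h x)) ξ := by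
    -- At `ξ = 0` the two sides may differ: the `l = 0` term need not vanish there, while the
    -- indicator does.
    filter_upwards [Measure.ae_ne volume (0 : ℝ)] with ξ hξ
    rw [Finset.sum_apply]
    rcases lt_or_gt_of_ne hξ with h0 | h0
    · rw [Set.indicator_of_mem (show ξ ∈ Set.Iio (0 : ℝ) from h0), fourier_mul_conj]
      -- The substitution `s = η + ξ` shifts `ĥ` instead of `û`. Since `-ξ > 0` and `û` lives on `s
      -- ≥ 0`, the binomial expansion applies to `s + (-ξ)`.
      have h2 := integral_add_right_eq_self (μ := (volume : Measure ℝ))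
        (fun s : ℝ => (𝓕 u : L2) s * conj ((𝓕 h : L2) (s - ξ))) ξ
      simp only [add_sub_cancel_right] at h2
      rw [h2]
      have e1 : ∀ᵐ s : ℝ, (𝓕 u : L2) s * conj ((𝓕 h : L2) (s - ξ))
          = ∑ l ∈ Finset.range (n + 1), (conj c * (n.choose l : ℂ) *
              halfLineExp (-Complex.I) l (-ξ)) *
              ((𝓕 u : L2) s * halfLineExp (-Complex.I) (n - l) s) := by
        filter_upwards [hu, (measurePreserving_sub_right volume ξ).quasiMeasurePreserving.ae hf]
          with s h1 h2
        rcases lt_or_ge s 0 with hs | hs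
        · simp [h1 hs]
        · rw [h2, sub_eq_add_neg, map_mul, conj_halfLineExp_neg_I,
            halfLineExp_add _ n (by linarith) hs, Finset.mul_sum, Finset.mul_sum]
          exact Finset.sum_congr rfl fun l _ => by ring
      rw [integral_congr_ae e1, integral_finsetSum _ fun l _ => (hint _).const_mul _]
      refine Finset.sum_congr rfl fun l _ => ?_
      rw [integral_const_mul, Pi.smul_apply, smul_eq_mul]
      ring
    · rw [Set.indicator_of_notMem (by simpa using h0.le)]
      exact Finset.sum_eq_zero fun l _ => by simp [halfLineExp_of_neg _ _ (neg_lt_zero.2 h0)]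
  refine spectra_congr (Submodule.sum_mem _ fun l hl => Submodule.smul_mem _ _
    (halfLineExp_neg_mem_spectra (Finset.mem_range.1 hl))) key

/-- On the real line the conjugate of `1 / (x + i) ^ (n + 1)` is `1 / (x - i) ^ (n + 1)`. The
product with `u` is in `L²` and splits into `H_u h` and its negative-frequency part, which is a
polynomial over the same denominator. -/
theorem hankel_simpleFraction {u : L2} (hu : u ∈ hardySobolev (1 / 2)) {n : ℕ} {h : hardySpace}
    (hh : h =ᵐ[volume] fun x : ℝ => 1 / ((x : ℂ) - -Complex.I) ^ (n + 1)) :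
    ∃ P : ℂ[X], (hankel u hu h : L2) =ᵐ[volume]
      fun x : ℝ => (u x - P.eval (x : ℂ)) / ((x : ℂ) - Complex.I) ^ (n + 1) := by
  obtain ⟨w, hw, e⟩ := negative_spectrum_mem hu.1 hh
  obtain ⟨P, hP⟩ := exists_polynomial_of_mem_poleSpace (by simp) hw
  have hprod : (fun x : ℝ => u x * conj ((h : L2) x)) =ᵐ[volume]
      fun x : ℝ => u x / ((x : ℂ) - Complex.I) ^ (n + 1) := by
    filter_upwards [hh] with x hx
    rw [hx]
    simp [div_eq_mul_inv, sub_eq_add_neg]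
  have hle : ∀ x : ℝ, 1 ≤ ‖(x : ℂ) - Complex.I‖ := fun x => by
    have := Complex.abs_im_le_norm ((x : ℂ) - Complex.I)
    simpa using this
  have hmem : MemLp (fun x : ℝ => u x * conj ((h : L2) x)) 2 volume := by
    refine (Lp.memLp u).of_le (integrable_mul_conj u h).1 ?_
    filter_upwards [hprod] with x hx
    rw [hx, norm_div, norm_pow]
    exact div_le_self (norm_nonneg _) (one_le_pow₀ (hle x))
  have hsum : hmem.toLp _ = (hankel u hu h : L2) + w := by
    refine eq_of_fourier_ae_eq ?_
    rw [FourierTransform.fourier_add]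
    filter_upwards [fourier_toLp_ae_eq _ (integrable_mul_conj u h) hmem, e, fourier_hankel u hu h,
      Lp.coeFn_add (𝓕 (hankel u hu h : L2) : L2) (𝓕 w : L2)] with ξ h1 h2 h3 h4
    rw [h1, h4, Pi.add_apply, h2, h3, szegoSpectrum]
    rcases lt_or_ge ξ 0 with h0 | h0
    · simp [Set.indicator, h0, not_le.2 h0]
    · simp [Set.indicator, h0, not_lt.2 h0]
  refine ⟨P, ?_⟩
  filter_upwards [hmem.coeFn_toLp, Lp.coeFn_add (hankel u hu h : L2) w, hP, hprod] with x h1 h2 h3 h4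
  rw [hsum, h2, Pi.add_apply, h3, h4] at h1
  rw [sub_div, ← h1, add_sub_cancel_right]

/-! ### The rank of a Hankel operator with rational symbol -/

theorem polynomial_eq_of_ae {P Q : ℂ[X]}
    (h : ∀ᵐ x : ℝ, P.eval (x : ℂ) = Q.eval (x : ℂ)) : P = Q := by
  have hc : (fun x : ℝ => P.eval (x : ℂ)) = fun x : ℝ => Q.eval (x : ℂ) :=
    (Continuous.ae_eq_iff_eq (volume : Measure ℝ) (P.continuous.comp Complex.continuous_ofReal)
      (Q.continuous.comp Complex.continuous_ofReal)).1 h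
  refine Polynomial.eq_of_infinite_eval_eq P Q
    ((Set.infinite_range_of_injective Complex.ofReal_injective).mono ?_)
  rintro _ ⟨x, rfl⟩
  exact congrFun hc x

theorem ae_eval_ne_zero {P : ℂ[X]} (hP : P ≠ 0) : ∀ᵐ x : ℝ, P.eval (x : ℂ) ≠ 0 := by
  have hfin : {x : ℝ | P.eval (x : ℂ) = 0}.Finite := by
    refine Set.Finite.of_finite_image (f := fun x : ℝ => (x : ℂ)) ?_
      Complex.ofReal_injective.injOn
    refine (P.rootSet_finite ℂ).subset ?_
    rintro _ ⟨x, hx, rfl⟩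
    rw [Polynomial.mem_rootSet]
    exact ⟨hP, by simpa using hx⟩
  rw [ae_iff]
  simpa using hfin.measure_zero volume

/-- If the Hankel operator has finite rank, then its symbol is a rational function, with a
denominator of degree at most the rank. -/
theorem exists_denominator {u : L2} (hu : u ∈ hardySobolev (1 / 2))
    [Module.Finite ℂ (LinearMap.range (hankel u hu))] :
    ∃ P Q : ℂ[X], Q ≠ 0 ∧ Q.natDegree ≤ Module.finrank ℂ (LinearMap.range (hankel u hu)) ∧
      ∀ᵐ x : ℝ, u x * Q.eval (x : ℂ) = P.eval (x : ℂ) := by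
  set d := Module.finrank ℂ (LinearMap.range (hankel u hu)) with hd
  have hI : (-Complex.I).im < 0 := by simp
  have hex : ∀ n : ℕ, ∃ h : hardySpace,
      (h : L2) =ᵐ[volume] fun x : ℝ => 1 / ((x : ℂ) - -Complex.I) ^ (n + 1) := fun n => by
    obtain ⟨e, he, c, -, hf⟩ := exists_simpleFraction hI n
    exact ⟨⟨e, mem_hardySpace_of_fourier hf⟩, he⟩
  choose h hh using hex
  choose P hP using fun n => hankel_simpleFraction hu (hh n)
  have hdep : ¬ LinearIndependent ℂ
      fun n : Fin (d + 1) => (⟨_, LinearMap.mem_range_self (hankel u hu) (h n)⟩ :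
        LinearMap.range (hankel u hu)) := fun hli => by
    have := hli.fintype_card_le_finrank
    rw [Fintype.card_fin] at this
    omega
  obtain ⟨c, hc, i, hi⟩ := Fintype.not_linearIndependent_iff.1 hdep
  have hsum : ∑ n : Fin (d + 1), c n • (hankel u hu (h n) : L2) = 0 := by
    have := congrArg (fun v : LinearMap.range (hankel u hu) => ((v : hardySpace) : L2)) hc
    simpa using this
  have hae : (0 : ℝ → ℂ) =ᵐ[volume] ∑ n : Fin (d + 1), c n • fun x : ℝ =>
      (u x - (P n).eval (x : ℂ)) / ((x : ℂ) - Complex.I) ^ ((n : ℕ) + 1) := by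
    have h0 : ∀ s : Finset (Fin (d + 1)),
        ((∑ n ∈ s, c n • (hankel u hu (h n) : L2) : L2) : ℝ → ℂ) =ᵐ[volume]
        ∑ n ∈ s, c n • fun x : ℝ =>
          (u x - (P n).eval (x : ℂ)) / ((x : ℂ) - Complex.I) ^ ((n : ℕ) + 1) := fun s => by
      induction s using Finset.cons_induction with
      | empty => exact Lp.coeFn_zero ℂ 2 volume
      | cons a s ha ih =>
        rw [Finset.sum_cons, Finset.sum_cons]
        exact (Lp.coeFn_add _ _).trans
          (((Lp.coeFn_smul (c a) _).trans ((hP a).const_smul (c a))).add ih)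
    have h1 := h0 Finset.univ
    rw [hsum] at h1
    exact (Lp.coeFn_zero ℂ 2 volume).symm.trans h1
  set Y : ℂ[X] := Polynomial.X - Polynomial.C Complex.I with hY
  -- Multiplying the dependence relation by `(x - i) ^ (d + 1)` leaves `c n * (u - P n) * (x - i) ^
  -- (d - n)`; the coefficient of `u` is `Q₀` evaluated at `x - i`. The exponents `d - n` are
  -- distinct, so `Q₀ ≠ 0`.
  set Q₀ : ℂ[X] := ∑ n : Fin (d + 1), Polynomial.C (c n) * Polynomial.X ^ (d - (n : ℕ)) with hQ₀
  have hQ0 : Q₀ ≠ 0 := fun h => by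
    have h1 := congrArg (fun q => Polynomial.coeff q (d - (i : ℕ))) h
    simp only [hQ₀, Polynomial.finsetSum_coeff, Polynomial.coeff_C_mul_X_pow,
      Polynomial.coeff_zero] at h1
    rw [Finset.sum_eq_single i] at h1
    · simp at h1
      exact hi h1
    · intro b _ hb
      rw [if_neg]
      intro h2
      exact hb (Fin.ext (by omega))
    · simp
  have hQ0d : Q₀.natDegree ≤ d :=
    Polynomial.natDegree_sum_le_of_forall_le _ _ fun n _ =>
      (Polynomial.natDegree_C_mul_X_pow_le _ _).trans (Nat.sub_le _ _)
  refine ⟨∑ n : Fin (d + 1), Polynomial.C (c n) * (P n * Y ^ (d - (n : ℕ))), Q₀.comp Y, ?_, ?_, ?_⟩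
  · intro h
    rcases Polynomial.comp_eq_zero_iff.1 h with h | ⟨-, h⟩
    · exact hQ0 h
    · exact Polynomial.X_sub_C_ne_zero Complex.I (by
        have := congrArg Polynomial.natDegree h
        simp [hY] at this)
  · rw [Polynomial.natDegree_comp, hY, Polynomial.natDegree_X_sub_C, mul_one]
    exact hQ0d
  · filter_upwards [hae] with x hx
    have hx0 : (x : ℂ) - Complex.I ≠ 0 := sub_ne_zero_of_im_ne_zero (by simp) x
    rw [Pi.zero_apply, Finset.sum_apply] at hx
    rw [← sub_eq_zero]
    simp only [hQ₀, hY, Polynomial.eval_comp, Polynomial.eval_finsetSum, Polynomial.eval_mul,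
      Polynomial.eval_C, Polynomial.eval_pow, Polynomial.eval_X, Polynomial.eval_sub]
    rw [Finset.mul_sum, ← Finset.sum_sub_distrib, ← mul_zero (((x : ℂ) - Complex.I) ^ (d + 1)), hx,
      Finset.mul_sum]
    refine Finset.sum_congr rfl fun n _ => ?_
    have hn : ((x : ℂ) - Complex.I) ^ (d + 1)
        = ((x : ℂ) - Complex.I) ^ (d - (n : ℕ)) * ((x : ℂ) - Complex.I) ^ ((n : ℕ) + 1) := by
      rw [← pow_add]
      congr 1
      omega
    rw [Pi.smul_apply, smul_eq_mul, hn]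
    field_simp

/-- There is at most one generator for each pair of a root and an order below its multiplicity, and
the multiplicities sum to at most the degree. -/
theorem finrank_poleSpace_le {B : ℂ[X]} :
    Module.Finite ℂ (poleSpace B) ∧ Module.finrank ℂ (poleSpace B) ≤ B.natDegree := by
  classical
  -- For a real pole no such class exists; the default `0` is then harmless, which is why `B` is
  -- arbitrary.
  have hex : ∀ q : (_ : ℂ) × ℕ, ∃ e : L2, ∀ e' : L2,
      (e' =ᵐ[volume] fun x : ℝ => 1 / ((x : ℂ) - q.1) ^ (q.2 + 1)) → e' = e := fun q => by
    by_cases h : ∃ e : L2, e =ᵐ[volume] fun x : ℝ => 1 / ((x : ℂ) - q.1) ^ (q.2 + 1)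
    · obtain ⟨e, he⟩ := h
      exact ⟨e, fun e' he' => Lp.ext (he'.trans he.symm)⟩
    · exact ⟨0, fun e' he' => (h ⟨e', he'⟩).elim⟩
  choose g hg using hex
  let s : Finset ((_ : ℂ) × ℕ) := B.roots.toFinset.sigma fun p => Finset.range (B.rootMultiplicity p)
  have hle : poleSpace B ≤ Submodule.span ℂ (s.image g : Finset L2) := by
    refine Submodule.span_mono ?_
    rintro e ⟨p, k, hk, he⟩
    refine Finset.mem_coe.2 (Finset.mem_image.2 ⟨⟨p, k⟩, ?_, (hg ⟨p, k⟩ e he).symm⟩)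
    refine Finset.mem_sigma.2 ⟨?_, Finset.mem_range.2 hk⟩
    rw [Multiset.mem_toFinset, ← Multiset.count_pos, Polynomial.count_roots]
    exact lt_of_le_of_lt (Nat.zero_le k) hk
  refine ⟨Submodule.finiteDimensional_of_le hle, ?_⟩
  calc _ ≤ _ := Submodule.finrank_mono hle
    _ ≤ (s.image g).card := finrank_span_finset_le_card _
    _ ≤ s.card := Finset.card_image_le
    _ = ∑ p ∈ B.roots.toFinset, B.roots.count p := by
      rw [Finset.card_sigma]
      simp [Polynomial.count_roots]
    _ = Multiset.card B.roots := Multiset.toFinset_sum_count_eq _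
    _ ≤ B.natDegree := Polynomial.card_roots' B

/-- The range of the Hankel operator with a rational symbol, and its rank. -/
theorem range_hankel_of_fraction {u : L2} (hu : u ∈ hardySobolev (1 / 2)) {A B : ℂ[X]}
    (hB : ∀ z : ℂ, 0 ≤ z.im → B.eval z ≠ 0) (hAB : IsCoprime A B) (hdeg : A.degree < B.degree)
    (huAB : u =ᵐ[volume] fun x : ℝ => A.eval (x : ℂ) / B.eval (x : ℂ)) :
    (LinearMap.range (hankel u hu)).map hardySpace.subtype = poleSpace B ∧
      Module.Finite ℂ (LinearMap.range (hankel u hu)) ∧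
      Module.finrank ℂ (LinearMap.range (hankel u hu)) = B.natDegree := by
  have hBr : ∀ x : ℝ, B.eval (x : ℂ) ≠ 0 := fun x => hB x (by simp)
  obtain ⟨v, hv, hvAB⟩ := simpleFractions_le_representatives hBr (div_mem_simpleFractions hdeg hBr)
  have hup : u ∈ poleSpace B := by rwa [Lp.ext (huAB.trans hvAB.symm)]
  have hle : (LinearMap.range (hankel u hu)).map hardySpace.subtype ≤ poleSpace B := by
    rintro _ ⟨_, ⟨h, rfl⟩, rfl⟩
    exact hankel_mem_poleSpace hB hu hup h
  obtain ⟨hfin, hrank⟩ := finrank_poleSpace_le (B := B)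
  let E := Submodule.equivMapOfInjective hardySpace.subtype hardySpace.injective_subtype
    (LinearMap.range (hankel u hu))
  have hfin' : Module.Finite ℂ ((LinearMap.range (hankel u hu)).map hardySpace.subtype) :=
    Submodule.finiteDimensional_of_le hle
  have hfin'' : Module.Finite ℂ (LinearMap.range (hankel u hu)) := Module.Finite.equiv E.symm
  -- Lower bound on the rank: the reduced denominator `B` divides `Q`, whose degree is at most the
  -- rank.
  obtain ⟨P, Q, hQ, hQd, hPQ⟩ := exists_denominator hu
  have hdvd : B ∣ Q := by
    refine hAB.symm.dvd_of_dvd_mul_left ⟨P, polynomial_eq_of_ae ?_⟩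
    filter_upwards [hPQ, huAB] with x h1 h2
    rw [Polynomial.eval_mul, Polynomial.eval_mul, ← h1, h2]
    field_simp [hBr x]
  have hlow := (Polynomial.natDegree_le_of_dvd hdvd hQ).trans hQd
  have hE := E.finrank_eq
  have heq : (LinearMap.range (hankel u hu)).map hardySpace.subtype = poleSpace B :=
    Submodule.eq_of_le_of_finrank_le hle (by omega)
  refine ⟨heq, hfin'', le_antisymm ?_ hlow⟩
  rw [hE, heq]
  exact hrank

/-! ### Square integrable rational functions -/

/-- A square integrable rational function has no poles on the real line. -/
theorem eval_real_ne_zero {u : L2} {A B : ℂ[X]} (hAB : IsCoprime A B)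
    (h : ∀ᵐ x : ℝ, u x * B.eval (x : ℂ) = A.eval (x : ℂ)) (t : ℝ) : B.eval (t : ℂ) ≠ 0 := by
  intro ht
  obtain ⟨C, hC⟩ := Polynomial.dvd_iff_isRoot.2 ht
  have hA : A.eval (t : ℂ) ≠ 0 := fun hA => by
    obtain ⟨a, b, hab⟩ := hAB
    have := congrArg (Polynomial.eval (t : ℂ)) hab
    simp [hA, ht] at this
  have hcont : Continuous fun x : ℝ => A.eval (x : ℂ) := A.continuous.comp Complex.continuous_ofReal
  obtain ⟨ε, hε, hball⟩ := Metric.eventually_nhds_iff.1 (hcont.continuousAt.eventually_ne hA)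
  set δ := ε / 2 with hδ
  have hA' : ∀ x ∈ Set.uIcc (t - δ) (t + δ), A.eval (x : ℂ) ≠ 0 := fun x hx => by
    rw [Set.uIcc_of_le (by linarith)] at hx
    refine hball ?_
    rw [Real.dist_eq, abs_lt]
    constructor <;> linarith [hx.1, hx.2]
  have hui : IntervalIntegrable (u : ℝ → ℂ) volume (t - δ) (t + δ) :=
    (((Lp.memLp u).locallyIntegrable (by norm_num)).integrableOn_isCompact
      isCompact_uIcc).intervalIntegrable
  have hq : ContinuousOn (fun x : ℝ => C.eval (x : ℂ) / A.eval (x : ℂ))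
      (Set.uIcc (t - δ) (t + δ)) :=
    (C.continuous.comp Complex.continuous_ofReal).continuousOn.div hcont.continuousOn hA'
  have hprod := (hui.mul_continuousOn hq).norm
  -- With `B = (X - t) C`, the product of `u` and the continuous function `C / A` is `1 / (x - t)`
  -- near `t`, which is not integrable there, although `u` is locally integrable.
  have hinv : IntervalIntegrable (fun x : ℝ => ‖(x - t)⁻¹‖) volume (t - δ) (t + δ) := by
    refine hprod.congr_ae ?_
    refine (ae_restrict_iff' measurableSet_uIoc).2 ?_
    filter_upwards [h, Measure.ae_ne volume t] with x hx hxt hmem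
    have h1 := hA' x (Set.uIoc_subset_uIcc hmem)
    have h2 : (x : ℂ) - t ≠ 0 := by
      rw [← Complex.ofReal_sub]
      exact_mod_cast sub_ne_zero.2 hxt
    rw [hC, Polynomial.eval_mul, Polynomial.eval_sub, Polynomial.eval_X, Polynomial.eval_C] at hx
    have h3 : u x * (C.eval (x : ℂ) / A.eval (x : ℂ)) = (((x - t)⁻¹ : ℝ) : ℂ) := by
      push_cast
      rw [mul_div_assoc', div_eq_iff h1, eq_inv_mul_iff_mul_eq₀ h2, ← hx]
      ring
    rw [h3, Complex.norm_real]
  refine not_intervalIntegrable_of_sub_inv_isBigO_punctured (c := t)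
    (Asymptotics.isBigO_norm_right.2 (Asymptotics.isBigO_refl (fun x : ℝ => (x - t)⁻¹) _))
    (by linarith) ?_ hinv
  rw [Set.uIcc_of_le (by linarith)]
  constructor <;> linarith

/-- A square integrable polynomial vanishes. -/
theorem polynomial_eq_zero_of_memLp {D : ℂ[X]}
    (h : MemLp (fun x : ℝ => D.eval (x : ℂ)) 2 (volume : Measure ℝ)) : D = 0 := by
  by_contra hD
  -- A nonzero polynomial is bounded away from zero on a half-line, which has infinite measure.
  obtain ⟨c, hc, M, hM⟩ : ∃ c : ℝ, 0 < c ∧ ∃ M : ℝ, ∀ x : ℝ, M ≤ x → c ≤ ‖D.eval (x : ℂ)‖ := by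
    by_cases hdeg : 0 < D.degree
    · have ht := D.tendsto_norm_atTop hdeg (l := Filter.atTop) (z := fun x : ℝ => (x : ℂ)) (by
        simpa using Filter.tendsto_abs_atTop_atTop)
      obtain ⟨M, hM⟩ := Filter.eventually_atTop.1 (ht.eventually_ge_atTop 1)
      exact ⟨1, one_pos, M, hM⟩
    · have hC := Polynomial.eq_C_of_degree_le_zero (not_lt.1 hdeg)
      refine ⟨‖D.coeff 0‖, norm_pos_iff.2 fun h0 => hD (by rw [hC, h0, Polynomial.C_0]), 0,
        fun x _ => ?_⟩
      rw [hC]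
      simp
  have hlt := h.meas_ge_lt_top (by norm_num) (by norm_num) (ε := ⟨c, hc.le⟩)
    (fun h0 => hc.ne' (congrArg NNReal.toReal h0))
  refine hlt.ne (measure_mono_top ?_ (Real.volume_Ici (a := M)))
  exact fun x hx => hM x hx

/-- Subtracting the proper fraction `(A % B) / B`, which is in `L²`, leaves the polynomial quotient;
being square integrable, it vanishes. -/
theorem degree_lt_of_ae {u : L2} {A B : ℂ[X]} (hB : ∀ x : ℝ, B.eval (x : ℂ) ≠ 0)
    (h : ∀ᵐ x : ℝ, u x * B.eval (x : ℂ) = A.eval (x : ℂ)) : A.degree < B.degree := by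
  have hB0 : B ≠ 0 := fun h0 => hB 0 (by simp [h0])
  have hlt : (A % B).degree < B.degree := EuclideanDomain.mod_lt A hB0
  obtain ⟨v, -, hv⟩ := simpleFractions_le_representatives hB (div_mem_simpleFractions hlt hB)
  have hdiv := EuclideanDomain.div_add_mod A B
  have hD : A / B = 0 := by
    refine polynomial_eq_zero_of_memLp ((memLp_congr_ae ?_).1 (Lp.memLp (u - v)))
    filter_upwards [h, hv, Lp.coeFn_sub u v] with x h1 h2 h3
    have h4 := congrArg (Polynomial.eval (x : ℂ)) hdiv
    rw [Polynomial.eval_add, Polynomial.eval_mul, ← h1] at h4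
    have h5 := hB x
    rw [h3, Pi.sub_apply, h2]
    field_simp
    linear_combination -h4
  rw [hD, mul_zero, zero_add] at hdiv
  rwa [hdiv] at hlt

/-! ### Rational functions in the Hardy space: excluding poles in the upper half-plane -/

/-- The span of the simple fractions with poles in a given set. -/
def fractionSpace (S : Set ℂ) : Submodule ℂ L2 :=
  Submodule.span ℂ {e | ∃ p ∈ S, ∃ k : ℕ, e =ᵐ[volume] fun x : ℝ => 1 / ((x : ℂ) - p) ^ (k + 1)}

theorem poleSpace_le_sup {B : ℂ[X]} (hB : ∀ x : ℝ, B.eval (x : ℂ) ≠ 0) :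
    poleSpace B ≤ fractionSpace {p | p.im < 0} ⊔ fractionSpace {p | 0 < p.im} := by
  refine Submodule.span_le.2 ?_
  rintro e ⟨p, k, hk, he⟩
  rcases lt_trichotomy p.im 0 with hp | hp | hp
  · exact Submodule.mem_sup_left (Submodule.subset_span ⟨p, hp, k, he⟩)
  · have h1 := hB p.re
    rw [show ((p.re : ℝ) : ℂ) = p from Complex.ext rfl (by simp [hp])] at h1
    rw [Polynomial.rootMultiplicity_eq_zero h1] at hk
    omega
  · exact Submodule.mem_sup_right (Submodule.subset_span ⟨p, hp, k, he⟩)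

theorem fractionSpace_lower_le_hardySpace : fractionSpace {p | p.im < 0} ≤ hardySpace := by
  refine Submodule.span_le.2 ?_
  rintro e ⟨p, hp, k, he⟩
  obtain ⟨c, -, h⟩ := fourier_simpleFraction hp he
  exact mem_hardySpace_of_fourier h

theorem fourier_eq_zero_of_mem_fractionSpace_upper {w : L2}
    (hw : w ∈ fractionSpace {p | 0 < p.im}) : ∀ᵐ ξ : ℝ, 0 < ξ → (𝓕 w : L2) ξ = 0 := by
  induction hw using Submodule.span_induction with
  | mem e he =>
    obtain ⟨p, hp, k, he⟩ := he
    obtain ⟨c, -, h⟩ := fourier_simpleFraction_upper hp he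
    filter_upwards [h] with ξ h1 h2
    rw [h1, halfLineExp_of_neg _ _ (neg_lt_zero.2 h2), mul_zero]
  | zero => exact Filter.Eventually.of_forall fun ξ _ => by simp
  | add v w _ _ hv hw =>
    rw [FourierTransform.fourier_add]
    filter_upwards [hv, hw, Lp.coeFn_add (𝓕 v : L2) (𝓕 w : L2)] with ξ h1 h2 h3 h4
    rw [h3, Pi.add_apply, h1 h4, h2 h4, add_zero]
  | smul c v _ hv =>
    rw [FourierTransform.fourier_smul]
    filter_upwards [hv, Lp.coeFn_smul c (𝓕 v : L2)] with ξ h1 h3 h4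
    rw [h3, Pi.smul_apply, h1 h4, smul_zero]

theorem eq_zero_of_fourier_eq_zero {w : L2} (h1 : ∀ᵐ ξ : ℝ, ξ < 0 → (𝓕 w : L2) ξ = 0)
    (h2 : ∀ᵐ ξ : ℝ, 0 < ξ → (𝓕 w : L2) ξ = 0) : w = 0 := by
  refine eq_of_fourier_ae_eq ?_
  rw [show (𝓕 (0 : L2) : L2) = 0 from (Lp.fourierTransformₗᵢ ℝ ℂ).map_zero]
  filter_upwards [h1, h2, Measure.ae_ne volume (0 : ℝ), Lp.coeFn_zero ℂ 2 (volume : Measure ℝ)]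
    with ξ h1 h2 h3 h4
  rw [h4]
  exact (lt_or_gt_of_ne h3).elim h1 h2

/-- Supplies some denominator without zeros in the closed upper half-plane; any reduced denominator
of the same function divides it. -/
theorem exists_fraction_of_mem_fractionSpace_lower {w : L2}
    (hw : w ∈ fractionSpace {p | p.im < 0}) :
    ∃ A B : ℂ[X], (∀ z : ℂ, 0 ≤ z.im → B.eval z ≠ 0) ∧
      ∀ᵐ x : ℝ, w x * B.eval (x : ℂ) = A.eval (x : ℂ) := by
  induction hw using Submodule.span_induction with
  | mem e he =>
    obtain ⟨p, hp, k, he⟩ := he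
    refine ⟨1, (Polynomial.X - Polynomial.C p) ^ (k + 1), fun z hz => ?_, ?_⟩
    · have : z - p ≠ 0 := fun h => by
        have h1 := congrArg Complex.im h
        simp at h1
        have h2 : p.im < 0 := hp
        linarith
      simpa using this
    · filter_upwards [he] with x hx
      have := sub_ne_zero_of_im_ne_zero (ne_of_lt hp) x
      rw [hx]
      simp [this]
  | zero => exact ⟨0, 1, by simp, by simp⟩
  | add v w _ _ hv hw =>
    obtain ⟨A, B, hB, h⟩ := hv
    obtain ⟨A', B', hB', h'⟩ := hw
    refine ⟨A * B' + A' * B, B * B', fun z hz => ?_, ?_⟩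
    · rw [Polynomial.eval_mul]
      exact mul_ne_zero (hB z hz) (hB' z hz)
    · filter_upwards [h, h', Lp.coeFn_add v w] with x h1 h2 h3
      rw [h3, Pi.add_apply, Polynomial.eval_add, Polynomial.eval_mul, Polynomial.eval_mul,
        Polynomial.eval_mul, ← h1, ← h2]
      ring
  | smul c v _ hv =>
    obtain ⟨A, B, hB, h⟩ := hv
    refine ⟨Polynomial.C c * A, B, hB, ?_⟩
    filter_upwards [h, Lp.coeFn_smul c v] with x h1 h3
    rw [h3, Pi.smul_apply, Polynomial.eval_mul, Polynomial.eval_C, ← h1, smul_eq_mul, mul_assoc]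

/-- A rational function in the Hardy space has no poles in the closed upper half-plane and
vanishes at infinity. -/
theorem fraction_of_mem_hardySpace {u : L2} (hu : u ∈ hardySpace) {A B : ℂ[X]}
    (hAB : IsCoprime A B) (h : ∀ᵐ x : ℝ, u x * B.eval (x : ℂ) = A.eval (x : ℂ)) :
    (∀ z : ℂ, 0 ≤ z.im → B.eval z ≠ 0) ∧ A.degree < B.degree := by
  have hBr := eval_real_ne_zero hAB h
  have hdeg := degree_lt_of_ae hBr h
  refine ⟨?_, hdeg⟩
  obtain ⟨v, hv, hv'⟩ := simpleFractions_le_representatives hBr (div_mem_simpleFractions hdeg hBr)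
  have huv : v = u := by
    refine Lp.ext ?_
    filter_upwards [hv', h] with x h1 h2
    rw [h1, ← h2, mul_div_cancel_right₀ _ (hBr x)]
  rw [huv] at hv
  obtain ⟨w, hw, w', hw', hsum⟩ := Submodule.mem_sup.1 (poleSpace_le_sup hBr hv)
  -- The upper part `w'` has no positive frequencies, and `w' = u - w` has no negative ones.
  have hw0 : w' = 0 := by
    refine eq_zero_of_fourier_eq_zero ?_ (fourier_eq_zero_of_mem_fractionSpace_upper hw')
    have : w' = u - w := by rw [← hsum, add_sub_cancel_left]
    rw [this]
    exact hardySpace.sub_mem hu (fractionSpace_lower_le_hardySpace hw)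
  rw [hw0, add_zero] at hsum
  rw [hsum] at hw
  obtain ⟨A', B', hB', h'⟩ := exists_fraction_of_mem_fractionSpace_lower hw
  have hdvd : B ∣ B' := by
    refine hAB.symm.dvd_of_dvd_mul_left ⟨A', polynomial_eq_of_ae ?_⟩
    filter_upwards [h, h'] with x h1 h2
    rw [Polynomial.eval_mul, Polynomial.eval_mul, ← h1, ← h2]
    ring
  intro z hz h0
  exact hB' z hz (Polynomial.eval_eq_zero_of_dvd_of_eval_eq_zero hdvd h0)

/-! ### From rank `N` to membership in `M(N)` -/

theorem IsFraction.degree_lt {N : ℕ} (hN : 1 ≤ N) {A B : ℂ[X]} (h : IsFraction N A B) :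
    A.degree < B.degree := by
  obtain ⟨-, hA, hB, -⟩ := h
  exact Polynomial.degree_lt_degree (by omega)

theorem exists_isFraction_of_rank {N : ℕ} (hN : 1 ≤ N) {u : L2} (hu : u ∈ hardySobolev (1 / 2))
    (hr : Module.rank ℂ (LinearMap.range (hankel u hu)) = (N : Cardinal)) : MemFractions N u := by
  have hfin : Module.Finite ℂ (LinearMap.range (hankel u hu)) := Module.finite_of_rank_eq_nat hr
  obtain ⟨P, Q, hQ, -, hPQ⟩ := exists_denominator hu
  have hG : EuclideanDomain.gcd P Q ≠ 0 := fun h => hQ (EuclideanDomain.gcd_eq_zero_iff.1 h).2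
  set G := EuclideanDomain.gcd P Q
  obtain ⟨A, hA⟩ : G ∣ P := EuclideanDomain.gcd_dvd_left P Q
  obtain ⟨B, hB⟩ : G ∣ Q := EuclideanDomain.gcd_dvd_right P Q
  have hAB : IsCoprime A B := by
    obtain ⟨a, b, hab⟩ : ∃ a b, G = P * a + Q * b := ⟨_, _, EuclideanDomain.gcd_eq_gcd_ab P Q⟩
    refine ⟨a, b, mul_left_cancel₀ hG ?_⟩
    linear_combination -hab - a * hA - b * hB
  have h : ∀ᵐ x : ℝ, u x * B.eval (x : ℂ) = A.eval (x : ℂ) := by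
    filter_upwards [hPQ, ae_eval_ne_zero hG] with x h1 h2
    rw [hA, hB, Polynomial.eval_mul, Polynomial.eval_mul] at h1
    refine mul_left_cancel₀ h2 ?_
    linear_combination h1
  obtain ⟨hBz, hdeg⟩ := fraction_of_mem_hardySpace hu.1 hAB h
  have huAB : u =ᵐ[volume] fun x : ℝ => A.eval (x : ℂ) / B.eval (x : ℂ) := by
    filter_upwards [h] with x hx
    rw [← hx, mul_div_cancel_right₀ _ (hBz x (by simp))]
  obtain ⟨-, -, hrank⟩ := range_hankel_of_fraction hu hBz hAB hdeg huAB
  rw [Module.finrank_eq_of_rank_eq hr] at hrank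
  have hb : B.eval 0 ≠ 0 := hBz 0 (by simp)
  have hb' := inv_ne_zero hb
  have hunit : IsUnit (Polynomial.C (B.eval 0)⁻¹) := Polynomial.isUnit_C.2 hb'.isUnit
  -- If `A = 0`, coprimality makes `B` a unit, so the rank would be `0`, against `1 ≤ N`.
  have hA0 : A ≠ 0 := fun h0 => by
    rw [h0, isCoprime_zero_left] at hAB
    rw [Polynomial.natDegree_eq_zero_of_isUnit hAB] at hrank
    omega
  -- Dividing both polynomials by `B(0)` achieves the normalisation `B(0) = 1`.
  refine ⟨_, ⟨Polynomial.C (B.eval 0)⁻¹ * A, Polynomial.C (B.eval 0)⁻¹ * B,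
    ⟨mul_ne_zero hunit.ne_zero hA0, ?_, ?_, ?_, ?_, ?_⟩, rfl⟩, ?_⟩
  · rw [Polynomial.natDegree_C_mul hb']
    have := Polynomial.natDegree_lt_natDegree hA0 hdeg
    omega
  · rw [Polynomial.natDegree_C_mul hb', hrank]
  · rw [Polynomial.eval_mul, Polynomial.eval_C, inv_mul_cancel₀ hb]
  · intro z hz
    rw [Polynomial.eval_mul, Polynomial.eval_C]
    exact mul_ne_zero hb' (hBz z hz)
  · exact (isCoprime_mul_unit_left hunit A B).2 hAB
  · filter_upwards [huAB] with x hx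
    rw [hx, Polynomial.eval_mul, Polynomial.eval_mul, Polynomial.eval_C, mul_div_mul_left _ _ hb']

/-! ### Comparing denominators, and the main theorem -/

theorem poleSpace_mono {B C : ℂ[X]} (hC : C ≠ 0) (h : B ∣ C) : poleSpace B ≤ poleSpace C := by
  refine Submodule.span_mono ?_
  rintro f ⟨p, k, hk, hf⟩
  exact ⟨p, k, hk.trans_le (Polynomial.rootMultiplicity_le_rootMultiplicity_of_dvd hC h p), hf⟩

theorem rootMultiplicity_prod_X_sub_C_pow {J : ℕ} (p : Fin J → ℂ) (m : Fin J → ℕ) (q : ℂ) :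
    (∏ j, (Polynomial.X - Polynomial.C (p j)) ^ m j).rootMultiplicity q
      = ∑ j, if p j = q then m j else 0 := by
  induction (Finset.univ : Finset (Fin J)) using Finset.cons_induction with
  | empty => simp
  | cons a s ha ih =>
    rw [Finset.prod_cons, Finset.sum_cons, Polynomial.rootMultiplicity_mul, ih]
    · congr 1
      split_ifs with h
      · rw [h, Polynomial.rootMultiplicity_X_sub_C_pow]
      · refine Polynomial.rootMultiplicity_eq_zero ?_
        simp [sub_eq_zero, Ne.symm h]
    · exact mul_ne_zero (pow_ne_zero _ (Polynomial.X_sub_C_ne_zero _))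
        (Finset.prod_ne_zero_iff.2 fun j _ => pow_ne_zero _ (Polynomial.X_sub_C_ne_zero _))

end Szego

end

theorem mainTheorem4 (N : ℕ) (hN : 1 ≤ N) :
    -- the functions in `M(N)` are admissible symbols
    (∀ f ∈ Szego.fractions N,
      ∃ u : Szego.L2, u ∈ Szego.hardySobolev (1 / 2) ∧ u =ᵐ[volume] f) ∧
    -- `u ∈ M(N)` if and only if the complex rank of `H_u` is `N`
    (∀ (u : Szego.L2) (hu : u ∈ Szego.hardySobolev (1 / 2)),
      Szego.MemFractions N u ↔
        Module.rank ℂ (LinearMap.range (Szego.hankel u hu)) = (N : Cardinal)) ∧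
    -- the range of `H_u` for `u ∈ M(N)`
    (∀ (u : Szego.L2) (hu : u ∈ Szego.hardySobolev (1 / 2)), Szego.MemFractions N u →
      ∀ (A : ℂ[X]) (J : ℕ) (p : Fin J → ℂ) (m : Fin J → ℕ),
        Function.Injective p → (∀ j, (p j).im < 0) → (∀ j, 1 ≤ m j) → ∑ j, m j = N →
        (u =ᵐ[volume] fun x : ℝ => A.eval (x : ℂ) / ∏ j, ((x : ℂ) - p j) ^ m j) →
        LinearMap.range (Szego.hankel u hu) =
          Submodule.span ℂ {g : Szego.hardySpace | ∃ j : Fin J, ∃ k : ℕ, 1 ≤ k ∧ k ≤ m j ∧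
            (g : Szego.L2) =ᵐ[volume] fun x : ℝ => 1 / ((x : ℂ) - p j) ^ k}) := by
  refine ⟨?_, fun u hu => ⟨?_, Szego.exists_isFraction_of_rank hN hu⟩, ?_⟩
  · rintro f ⟨A, B, hAB, rfl⟩
    have hB := hAB.2.2.2.2.1
    have hBr : ∀ x : ℝ, B.eval (x : ℂ) ≠ 0 := fun x => hB x (by simp)
    obtain ⟨u, hu, he⟩ := Szego.simpleFractions_le_representatives hBr
      (Szego.div_mem_simpleFractions (hAB.degree_lt hN) hBr)
    exact ⟨u, Szego.poleSpace_le_hardySobolevHalf hB hu, he⟩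
  · rintro ⟨f, ⟨A, B, hAB, rfl⟩, hf⟩
    obtain ⟨-, hfin, hrank⟩ := Szego.range_hankel_of_fraction hu hAB.2.2.2.2.1 hAB.2.2.2.2.2
      (hAB.degree_lt hN) hf
    rw [← Module.finrank_eq_rank, hrank, hAB.2.2.1]
  · rintro u hu ⟨f, ⟨A₀, B, hAB, rfl⟩, hf⟩ A J p m hp him hm hsum huA
    have hB := hAB.2.2.2.2.1
    have hB0 : B ≠ 0 := fun h => hB 0 (by simp) (by simp [h])
    obtain ⟨hrange, -⟩ := Szego.range_hankel_of_fraction hu hB hAB.2.2.2.2.2 (hAB.degree_lt hN) hf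
    set C : ℂ[X] := ∏ j, (Polynomial.X - Polynomial.C (p j)) ^ m j with hC
    have hCm : C.Monic := Polynomial.monic_prod_of_monic _ _ fun j _ =>
      (Polynomial.monic_X_sub_C (p j)).pow (m j)
    have hCd : C.natDegree = N := by
      rw [hC, Polynomial.natDegree_prod_of_monic _ _ fun j _ =>
        (Polynomial.monic_X_sub_C (p j)).pow (m j), ← hsum]
      exact Finset.sum_congr rfl fun j _ => by simp
    have hCx : ∀ x : ℝ, C.eval (x : ℂ) = ∏ j, ((x : ℂ) - p j) ^ m j := fun x => by
      simp [hC, Polynomial.eval_prod]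
    -- `A` is not assumed coprime to `C`. Divisibility comes from the reduced form `A₀ / B`, and
    -- equality of the degrees (both `N`) then makes `B` and `C` associated.
    have hBC : B ∣ C := by
      refine hAB.2.2.2.2.2.symm.dvd_of_dvd_mul_left ⟨A, Szego.polynomial_eq_of_ae ?_⟩
      filter_upwards [hf, huA] with x h1 h2
      have h3 : B.eval (x : ℂ) ≠ 0 := hB x (by simp)
      have h4 : C.eval (x : ℂ) ≠ 0 := by
        rw [hCx]
        exact Finset.prod_ne_zero_iff.2 fun j _ =>
          pow_ne_zero _ (Szego.sub_ne_zero_of_im_ne_zero (him j).ne x)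
      rw [← hCx, h1, div_eq_div_iff h3 h4] at h2
      rw [Polynomial.eval_mul, Polynomial.eval_mul, h2, mul_comm]
    have hCB : C ∣ B := by
      refine (Polynomial.associated_of_dvd_of_natDegree_le hBC hCm.ne_zero ?_).symm.dvd
      rw [hCd, hAB.2.2.1]
    have hpole : Szego.poleSpace B = Szego.poleSpace C :=
      le_antisymm (Szego.poleSpace_mono hCm.ne_zero hBC) (Szego.poleSpace_mono hB0 hCB)
    -- The range lies in the Hardy space and `poleSpace` in `L²`, so the images in `L²` are
    -- compared.
    refine Submodule.map_injective_of_injective Szego.hardySpace.injective_subtype ?_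
    rw [hrange, hpole, Submodule.map_span, Szego.poleSpace]
    congr 1
    ext e
    simp only [Set.mem_ofPred_eq, Set.mem_image, hC, Szego.rootMultiplicity_prod_X_sub_C_pow]
    constructor
    · rintro ⟨q, k, hk, he⟩
      obtain ⟨j, -, hj⟩ := Finset.exists_ne_zero_of_sum_ne_zero (Nat.ne_zero_of_lt hk)
      have hj' : p j = q := by
        by_contra h
        exact hj (if_neg h)
      subst hj'
      simp only [hp.eq_iff, Finset.sum_ite_eq', Finset.mem_univ, if_true] at hk
      obtain ⟨c, -, hfe⟩ := Szego.fourier_simpleFraction (him j) he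
      exact ⟨⟨e, Szego.mem_hardySpace_of_fourier hfe⟩, ⟨j, k + 1, by omega, hk, he⟩, rfl⟩
    · rintro ⟨g, ⟨j, k, hk1, hk, hg⟩, rfl⟩
      -- Orders run over `1 ≤ k ≤ m j` here and over `k + 1` with `k < m j` in `poleSpace`.
      refine ⟨p j, k - 1, ?_, ?_⟩
      · simp only [hp.eq_iff, Finset.sum_ite_eq', Finset.mem_univ, if_true]
        omega
      · rw [Nat.sub_add_cancel hk1]
        exact hg
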